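/- **Setting.** Let $G$ be a compact (Hausdorff, second countable) topological group, for instance a compact Lie group or a finite group, with normalised Haar measure. Let $\mathcal L$ be a finite oriented lattice with vertex set $\mathcal V$, edge set $\mathcal E$ and global boundary $\mathcal B\subseteq\mathcal V$. For $F\subseteq\mathcal E$, gauge transformations act on $L^2(G^F)$ by $U(\mathbf h)|x\rangle=|(h_{t(e)}x_eh_{s(e)}^{-1})_{e\in F}\rangle$, where $s(e),t(e)$ are the initial and final vertices of $e$. Let $\Sigma$ be a region with corner $\partial\Sigma\subseteq\mathcal V\setminus\mathcal B$: a set $\mathcal E_\Sigma$ of edges with endpoints in $\mathring\Sigma\cup\partial\Sigma$ that contains every edge touching an interior vertex (a vertex of $\mathring\Sigma$); here $\mathring\Sigma\cap\partial\Sigma=\emptyset$. Let $\mathcal H(F)\subseteq L^2(G^F)$ be the subspace of states invariant under gauge transformations at all vertices outside $\mathcal B\cup\partial\Sigma$, and put $\mathcal H^{\rm phys}_\Sigma=\mathcal H(\mathcal E_\Sigma)$, $\mathcal H_{\rm kin}^{\partial\Sigma}=\mathcal H(\mathcal E)$. For $F\supseteq \mathcal E_\Sigma$ one has $\mathcal H(F)=\mathcal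 H_\Sigma^{\rm phys}\otimes\mathcal H(F\setminus\mathcal E_\Sigma)$, and $\mathcal A_\Sigma=\mathcal B(\mathcal H_\Sigma^{\rm phys})$ acts on $\mathcal H(F)$ as $\mathcal B(\mathcal H_\Sigma^{\rm phys})\otimes 1$. The corner gauge group $\mathcal G_{\partial\Sigma}=G^{\partial\Sigma}$ acts unitarily on $\mathcal H_{\rm kin}^{\partial\Sigma}$ by $U$. Let $\Pi=\Pi^{\rm phys}_{\partial\Sigma}=\int_{\mathcal G_{\partial\Sigma}}d\mathbf g\,U(\mathbf g)$ and $\hat\Pi(\bullet)=\Pi\bullet\Pi$, and let $\mathcal A_\Sigma^{\mathcal G_{\partial\Sigma}}$ be the set of elements of $\mathcal A_\Sigma$ commuting with all $U(\mathbf g)$. An *extrinsic frame* $\Phi$ consists of a simple path from $\mathcal B$ to $v$ for each $v\in\partial\Sigma$, using no edge of $\Sigma$ and meeting $\mathcal B$ only in its initial vertex, such that paths to different corner vertices share no edges. Its orientation in a configuration $x\in G^{\mathcal E}$ is the family of path-ordered holonomies $g_v=g_n\cdots g_1$ along these paths. Let $\mathcal E_{S}$ be $\mathcal E$ without the last edges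 of the paths, and $\mathcal H_S=\mathcal H(\mathcal E_S)$. In the coordinates $x\mapsto(\text{orientation of }\Phi,\ x|_{\mathcal E_S})$, the reduction map is $\mathcal R_\Phi(\mathbf g)=\langle\mathbf g|_\Phi\otimes 1_S:\Pi\mathcal H_{\rm kin}^{\partial\Sigma}\to\mathcal H_S$; its adjoint is $(\mathcal R_\Phi(\mathbf g)^\dagger f)(x)=f(x'|_{\mathcal E_S})$, where $x'$ is the corner gauge transform of $x$ in which $\Phi$ has orientation $\mathbf g$. The *relational algebra* of $\Sigma$ relative to $\Phi$ is $\mathcal A^{\rm phys}_{\Sigma|\Phi}=\mathcal R_\Phi(\mathbf g)^\dagger\mathcal A_\Sigma\mathcal R_\Phi(\mathbf g)$, where the choice of the orientation $\mathbf g\in G^{\partial\Sigma}$ is arbitrary. The reorientation $V_\Phi(\mathbf h)$, $\mathbf h\in\mathbb G_{\partial\Sigma}\simeq G^{\partial\Sigma}$, multiplies the parallel transport along the first edge of the path to $v$ on the right by $h_v^{-1}$, for every $v\in\partial\Sigma$, and $\mathbb G_{\partial\Sigma}(O)=\int d\mathbf h\,V_\Phi(\mathbf h)\,O\,V_\Phi(\mathbf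 h)^\dagger$. All operators on $\Pi\mathcal H_{\rm kin}^{\partial\Sigma}$ are extended by zero to $\mathcal H_{\rm kin}^{\partial\Sigma}$, and all operator integrals are strong integrals. **Corollary (center algebras from intersections of factors).** Suppose that the lattice is large enough to admit two non-overlapping extrinsic frames for $\partial\Sigma$ (no edge of a path of the first is an edge of a path of the second). Define the electric center algebra $\mathcal A_E:=\hat\Pi^{\rm phys}_{\partial\Sigma}(\mathcal A_\Sigma)$. Then $$\bigcap_{\text{extrinsic frames }\Phi}\mathcal A^{\rm phys}_{\Sigma|\Phi}\;=\;\mathcal A_E\;=\;\mathcal A_\Sigma^{\mathcal G_{\partial\Sigma}}\,\Pi^{\rm phys}_{\partial\Sigma},$$ and for every extrinsic frame $\Phi$ the twirl over its reorientation group satisfies $$\mathbb G_{\partial\Sigma}\big(\mathcal A^{\rm phys}_{\Sigma|\Phi}\big)=\mathcal A_E .$$ -/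

import Mathlib

open MeasureTheory

set_option linter.unusedSectionVars false

namespace LatticeGauge

/-! ### Compact structure group: normalised Haar measure -/

section Haar

variable (G : Type*) [Group G] [TopologicalSpace G] [IsTopologicalGroup G] [CompactSpace G]
  [MeasurableSpace G] [BorelSpace G]

/-- The Haar probability measure `dg / Vol(G)` of a compact group. -/
noncomputable def haarProb : Measure G := Measure.haarMeasure ⊤

instance : (haarProb G).IsHaarMeasure := by unfold haarProb; infer_instance

instance : IsProbabilityMeasure (haarProb G) :=
  ⟨by simpa [haarProb] using Measure.haarMeasure_self (K₀ := (⊤ : TopologicalSpace.PositiveCompacts G))⟩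

instance : (haarProb G).IsMulRightInvariant := by
  refine ⟨fun g => ?_⟩
  have : IsProbabilityMeasure ((haarProb G).map (fun x => x * g)) :=
    Measure.isProbabilityMeasure_map (by fun_prop)
  exact Measure.isHaarMeasure_eq_of_isProbabilityMeasure _ _

end Haar

/-! ### Strongly continuous unitary representations, coherent averages and twirls -/

/-- A strongly continuous unitary representation of a topological group. -/
structure UnitaryRep (Γ H : Type*) [Group Γ] [TopologicalSpace Γ]
    [NormedAddCommGroup H] [InnerProductSpace ℂ H] where
  toHom : Γ →* (H ≃ₗᵢ[ℂ] H)
  cont : ∀ ψ : H, Continuous fun γ => toHom γ ψ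

namespace UnitaryRep

variable {Γ H : Type*} [Group Γ] [TopologicalSpace Γ]
  [NormedAddCommGroup H] [InnerProductSpace ℂ H] (U : UnitaryRep Γ H)

/-- The unitary operator `U(γ)` as a bounded operator. -/
def op (γ : Γ) : H →L[ℂ] H := (U.toHom γ).toContinuousLinearEquiv.toContinuousLinearMap

@[simp] theorem op_apply (γ : Γ) (ψ : H) : U.op γ ψ = U.toHom γ ψ := rfl

/-- The closed subspace of invariant vectors. -/
def invariants : Submodule ℂ H where
  carrier := {ψ | ∀ γ, U.toHom γ ψ = ψ}
  add_mem' := by intro a b ha hb γ; rw [map_add, ha γ, hb γ]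
  zero_mem' := by intro γ; simp
  smul_mem' := by intro c a ha γ; rw [map_smul, ha γ]

theorem mem_invariants {ψ : H} : ψ ∈ U.invariants ↔ ∀ γ, U.toHom γ ψ = ψ := Iff.rfl

theorem isClosed_invariants : IsClosed (U.invariants : Set H) := by
  have : (U.invariants : Set H) = ⋂ γ, {ψ | U.toHom γ ψ = ψ} := by
    ext ψ; simp [mem_invariants]
  rw [this]
  exact isClosed_iInter fun γ => isClosed_eq (U.toHom γ).continuous continuous_id

instance [CompleteSpace H] : CompleteSpace U.invariants :=
  U.isClosed_invariants.completeSpace_coe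

/-- Restriction of a representation to an invariant subspace. -/
def restrict (K : Submodule ℂ H) (hK : ∀ γ, ∀ ψ ∈ K, U.toHom γ ψ ∈ K) : UnitaryRep Γ K where
  toHom :=
    { toFun := fun γ =>
        { toFun := fun ψ => ⟨U.toHom γ ψ, hK γ ψ ψ.2⟩
          invFun := fun ψ => ⟨U.toHom γ⁻¹ ψ, hK γ⁻¹ ψ ψ.2⟩
          left_inv := fun ψ => by ext; simp
          right_inv := fun ψ => by ext; simp
          map_add' := fun ψ φ => by ext; simp
          map_smul' := fun c ψ => by ext; simp
          norm_map' := fun ψ => by simp }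
      map_one' := by ext; simp
      map_mul' := fun a b => by ext; simp }
  cont := fun ψ => (U.cont ψ).subtype_mk _

@[simp] theorem restrict_apply (K : Submodule ℂ H) (hK) (γ : Γ) (ψ : K) :
    (((U.restrict K hK).toHom γ ψ : K) : H) = U.toHom γ ψ := rfl

variable [IsTopologicalGroup Γ] [CompactSpace Γ] [MeasurableSpace Γ] [BorelSpace Γ]
  [CompleteSpace H] (μ : Measure Γ) [IsProbabilityMeasure μ]

theorem continuous_conj (O : H →L[ℂ] H) (ψ : H) :
    Continuous fun γ => U.toHom γ (O (U.toHom γ⁻¹ ψ)) := by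
  have h1 : Continuous fun γ => O (U.toHom γ⁻¹ ψ) :=
    O.continuous.comp ((U.cont ψ).comp continuous_inv)
  rw [continuous_iff_continuousAt]
  intro γ₀
  have h2 := (U.cont (O (U.toHom γ₀⁻¹ ψ))).tendsto γ₀
  have h3 : Filter.Tendsto
      (fun γ => U.toHom γ (O (U.toHom γ⁻¹ ψ)) - U.toHom γ (O (U.toHom γ₀⁻¹ ψ)))
      (nhds γ₀) (nhds 0) := by
    rw [tendsto_zero_iff_norm_tendsto_zero]
    have h4 := (h1.tendsto γ₀).sub_const (O (U.toHom γ₀⁻¹ ψ))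
    rw [sub_self] at h4
    simpa [← map_sub] using h4.norm
  simpa [ContinuousAt] using h3.add h2

theorem integrable_of_continuous {f : Γ → H} (hf : Continuous f) : Integrable f μ :=
  hf.integrable_of_hasCompactSupport (HasCompactSupport.of_compactSpace f)

/-- The coherent group average `∫ dγ U(γ)`, as a strong integral. -/
noncomputable def average : H →L[ℂ] H :=
  LinearMap.mkContinuous
    { toFun := fun ψ => ∫ γ, U.toHom γ ψ ∂μ
      map_add' := fun ψ φ => by
        simp only [map_add]
        exact integral_add (integrable_of_continuous μ (U.cont ψ))
          (integrable_of_continuous μ (U.cont φ))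
      map_smul' := fun c ψ => by
        simp only [map_smul]
        exact integral_smul c _ } 1
    (fun ψ => by
      have := norm_integral_le_of_norm_le_const (μ := μ) (C := ‖ψ‖)
        (f := fun γ => U.toHom γ ψ) (Filter.Eventually.of_forall fun γ => by simp)
      simpa using this)

theorem average_apply (ψ : H) : U.average μ ψ = ∫ γ, U.toHom γ ψ ∂μ := rfl

/-- The incoherent group average (`G`-twirl) `O ↦ ∫ dγ U(γ) O U(γ)†`, as a strong integral. -/
noncomputable def twirl (O : H →L[ℂ] H) : H →L[ℂ] H :=
  LinearMap.mkContinuous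
    { toFun := fun ψ => ∫ γ, U.toHom γ (O (U.toHom γ⁻¹ ψ)) ∂μ
      map_add' := fun ψ φ => by
        simp only [map_add]
        exact integral_add (integrable_of_continuous μ (U.continuous_conj O ψ))
          (integrable_of_continuous μ (U.continuous_conj O φ))
      map_smul' := fun c ψ => by
        simp only [map_smul]
        exact integral_smul c _ } ‖O‖
    (fun ψ => by
      have := norm_integral_le_of_norm_le_const (μ := μ) (C := ‖O‖ * ‖ψ‖)
        (f := fun γ => U.toHom γ (O (U.toHom γ⁻¹ ψ))) (Filter.Eventually.of_forall fun γ => by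
          simpa using O.le_opNorm (U.toHom γ⁻¹ ψ))
      simpa using this)

theorem twirl_apply (O : H →L[ℂ] H) (ψ : H) :
    U.twirl μ O ψ = ∫ γ, U.toHom γ (O (U.toHom γ⁻¹ ψ)) ∂μ := rfl

end UnitaryRep

/-! ### Link variables and two-sided multiplication -/

section Links

variable (G : Type*) [Group G] [TopologicalSpace G] [IsTopologicalGroup G] [CompactSpace G]
  [MeasurableSpace G] [BorelSpace G]

/-- The product Haar probability measure on `G^ι`. -/
noncomputable abbrev haarPi (ι : Type*) [Fintype ι] : Measure (ι → G) :=
  Measure.pi fun _ => haarProb G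

/-- The Hilbert space `⨂_{e ∈ F} L²(G) = L²(G^F)` of a finite set `F` of links. -/
abbrev LinkSpace {E : Type*} (F : Finset E) : Type _ := Lp ℂ 2 (haarPi G F)

variable {G}

section Act

variable {Γ : Type*} [Group Γ] [TopologicalSpace Γ] {ι : Type*}

/-- The action of `γ ∈ Γ` on `G^ι` multiplying the `i`-th entry by `l i γ` on the left and by
`(r i γ)⁻¹` on the right. -/
def linkAct (l r : ι → (Γ →ₜ* G)) (γ : Γ) (x : ι → G) : ι → G :=
  fun i => l i γ * x i * (r i γ)⁻¹

theorem linkAct_one (l r : ι → (Γ →ₜ* G)) : linkAct l r 1 = id := by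
  funext x i; simp [linkAct]

theorem linkAct_mul (l r : ι → (Γ →ₜ* G)) (γ δ : Γ) :
    linkAct l r (γ * δ) = linkAct l r γ ∘ linkAct l r δ := by
  funext x i; simp [linkAct, mul_assoc]

variable [Fintype ι]

theorem continuous_linkAct (l r : ι → (Γ →ₜ* G)) :
    Continuous fun p : Γ × (ι → G) => linkAct l r p.1 p.2 := by
  refine continuous_pi fun i => ?_
  have h1 : Continuous fun p : Γ × (ι → G) => l i p.1 := (l i).continuous.comp continuous_fst
  have h2 : Continuous fun p : Γ × (ι → G) => r i p.1 := (r i).continuous.comp continuous_fst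
  have h3 : Continuous fun p : Γ × (ι → G) => p.2 i := (continuous_apply i).comp continuous_snd
  exact (h1.mul h3).mul h2.inv

theorem measurePreserving_linkAct (l r : ι → (Γ →ₜ* G)) (γ : Γ) :
    MeasurePreserving (linkAct l r γ) (haarPi G ι) (haarPi G ι) :=
  measurePreserving_pi _ _ fun i =>
    (measurePreserving_mul_right (haarProb G) (r i γ)⁻¹).comp
      (measurePreserving_mul_left (haarProb G) (l i γ))

variable [T2Space G] [SecondCountableTopology G]

/-- The induced unitary representation on `L²(G^ι)`: `U(γ)|x⟩ = |γ·x⟩`, that is,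
`(U(γ)ψ)(x) = ψ(γ⁻¹·x)`. -/
noncomputable def linkRep (l r : ι → (Γ →ₜ* G)) [IsTopologicalGroup Γ] :
    UnitaryRep Γ (Lp ℂ 2 (haarPi G ι)) where
  toHom :=
    { toFun := fun γ =>
        { Lp.compMeasurePreservingₗᵢ ℂ (linkAct l r γ⁻¹) (measurePreserving_linkAct l r γ⁻¹) with
          invFun := Lp.compMeasurePreservingₗᵢ ℂ (linkAct l r γ) (measurePreserving_linkAct l r γ)
          left_inv := fun ψ => by
            change Lp.compMeasurePreserving _ _ (Lp.compMeasurePreserving _ _ ψ) = ψ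
            rw [← Lp.compMeasurePreserving_comp_apply]
            have : linkAct l r γ⁻¹ ∘ linkAct l r γ = id := by
              rw [← linkAct_mul, inv_mul_cancel, linkAct_one]
            simp only [this]
            exact Lp.compMeasurePreserving_id_apply ψ
          right_inv := fun ψ => by
            change Lp.compMeasurePreserving _ _ (Lp.compMeasurePreserving _ _ ψ) = ψ
            rw [← Lp.compMeasurePreserving_comp_apply]
            have : linkAct l r γ ∘ linkAct l r γ⁻¹ = id := by
              rw [← linkAct_mul, mul_inv_cancel, linkAct_one]
            simp only [this]
            exact Lp.compMeasurePreserving_id_apply ψ }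
      map_one' := by
        ext1 ψ
        change Lp.compMeasurePreserving _ _ ψ = ψ
        simp only [inv_one, linkAct_one]
        exact Lp.compMeasurePreserving_id_apply ψ
      map_mul' := fun γ δ => by
        ext1 ψ
        change Lp.compMeasurePreserving _ _ ψ =
          Lp.compMeasurePreserving _ _ (Lp.compMeasurePreserving _ _ ψ)
        rw [← Lp.compMeasurePreserving_comp_apply]
        simp only [mul_inv_rev, linkAct_mul] }
  cont := fun ψ => by
    let g : Γ → C(ι → G, ι → G) := fun γ =>
      ⟨linkAct l r γ⁻¹, (continuous_linkAct l r).comp (by fun_prop : Continuous fun x => (γ⁻¹, x))⟩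
    have hg : Continuous g := by
      refine ContinuousMap.continuous_of_continuous_uncurry g ?_
      exact (continuous_linkAct l r).comp
        (by fun_prop : Continuous fun p : Γ × (ι → G) => (p.1⁻¹, p.2))
    exact Continuous.compMeasurePreservingLp (p := 2) continuous_const hg
      (fun γ => measurePreserving_linkAct l r γ⁻¹) (by simp)

theorem linkRep_apply (l r : ι → (Γ →ₜ* G)) [IsTopologicalGroup Γ] (γ : Γ)
    (ψ : Lp ℂ 2 (haarPi G ι)) :
    (linkRep l r).toHom γ ψ =
      Lp.compMeasurePreserving (linkAct l r γ⁻¹) (measurePreserving_linkAct l r γ⁻¹) ψ := rfl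

end Act

end Links


/-! ### Lattices, regions, extrinsic frames -/

/-- A finite oriented lattice with vertices `V`, edges `E` and global boundary `boundary`. -/
structure Lattice (V E : Type*) where
  src : E → V
  tgt : E → V
  boundary : Finset V

namespace Lattice

variable {V E : Type*} (L : Lattice V E)

/-- A step along an edge: `(e, true)` follows the orientation of `e`, `(e, false)` is opposite. -/
abbrev Step (E : Type*) := E × Bool

/-- Initial vertex of a step. -/
def ini (s : Step E) : V := if s.2 then L.src s.1 else L.tgt s.1

/-- Final vertex of a step. -/
def fin (s : Step E) : V := if s.2 then L.tgt s.1 else L.src s.1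

end Lattice

/-- A region `Σ` of the lattice: its interior vertices, its corner vertices `∂Σ` and its edges
(interior edges together with the edges lying in `∂Σ`). The corner consists of bulk vertices and
separates the interior of `Σ` from its complement. -/
structure Region {V E : Type*} [DecidableEq V] (L : Lattice V E) where
  interior : Finset V
  corner : Finset V
  edges : Finset E
  disjoint_interior_corner : Disjoint interior corner
  disjoint_corner_boundary : Disjoint corner L.boundary
  src_mem : ∀ e ∈ edges, L.src e ∈ interior ∪ corner
  tgt_mem : ∀ e ∈ edges, L.tgt e ∈ interior ∪ corner
  mem_of_src : ∀ e, L.src e ∈ interior → e ∈ edges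
  mem_of_tgt : ∀ e, L.tgt e ∈ interior → e ∈ edges

/-- An extrinsic frame `Φ` for `∂Σ`: for each corner vertex `v` a path (without repeated vertices)
from its anchor point on the global boundary to `v`, running outside `Σ` and meeting the global
boundary only at the anchor point; paths to different corner vertices do not share edges. -/
structure ExtrinsicFrame {V E : Type*} [DecidableEq V] {L : Lattice V E} (R : Region L) where
  line : ↥R.corner → List (Lattice.Step E)
  ne_nil : ∀ v, line v ≠ []
  chain : ∀ v, (line v).IsChain fun s t => L.fin s = L.ini t
  anchored : ∀ v, L.ini ((line v).head (ne_nil v)) ∈ L.boundary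
  off_boundary : ∀ v, ∀ s ∈ line v, L.fin s ∉ L.boundary
  reaches : ∀ v, L.fin ((line v).getLast (ne_nil v)) = v
  simple : ∀ v, ((line v).map L.fin).Nodup
  extrinsic : ∀ v, ∀ s ∈ line v, s.1 ∉ R.edges
  edge_disjoint : ∀ v w, v ≠ w → ∀ s ∈ line v, ∀ t ∈ line w, s.1 ≠ t.1

namespace ExtrinsicFrame

variable {V E : Type*} [DecidableEq V] [DecidableEq E] {L : Lattice V E} {R : Region L}

/-- Two extrinsic frames are non-overlapping if the edges of their Wilson lines do not overlap. -/
def NonOverlapping (Φ Φ' : ExtrinsicFrame R) : Prop :=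
  ∀ v w, ∀ s ∈ Φ.line v, ∀ t ∈ Φ'.line w, s.1 ≠ t.1

variable (Φ : ExtrinsicFrame R)

/-- The first step of the Wilson line to `v`, starting on the global boundary. -/
def firstStep (v : ↥R.corner) : Lattice.Step E := (Φ.line v).head (Φ.ne_nil v)

/-- The last step of the Wilson line to `v`, ending at `v`. -/
def lastStep (v : ↥R.corner) : Lattice.Step E := (Φ.line v).getLast (Φ.ne_nil v)

/-- The set of last edges of the Wilson lines of `Φ`. -/
def lastEdges : Finset E := Finset.univ.image fun v => (Φ.lastStep v).1

theorem lastStep_mem (v : ↥R.corner) : Φ.lastStep v ∈ Φ.line v := List.getLast_mem _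

theorem lastStep_injective {v w : ↥R.corner} (h : (Φ.lastStep v).1 = (Φ.lastStep w).1) :
    v = w := by
  by_contra hne
  exact Φ.edge_disjoint v w hne _ (Φ.lastStep_mem v) _ (Φ.lastStep_mem w) h

/-- The last edge of a Wilson line is not used by any other step of the lines of the frame. -/
theorem fst_notMem_lastEdges {v : ↥R.corner} {s : Lattice.Step E}
    (hs : s ∈ (Φ.line v).dropLast) : s.1 ∉ Φ.lastEdges := by
  intro hmem
  obtain ⟨w, -, hw⟩ := Finset.mem_image.1 hmem
  have hsl : s ∈ Φ.line v := List.mem_of_mem_dropLast hs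
  rcases eq_or_ne w v with rfl | hne
  · have hdec : (Φ.line w).dropLast ++ [Φ.lastStep w] = Φ.line w :=
      List.dropLast_append_getLast (Φ.ne_nil w)
    have hnodup := Φ.simple w
    rw [← hdec, List.map_append, List.nodup_append] at hnodup
    have key : ∀ t ∈ (Φ.line w).dropLast, L.fin t ≠ L.fin (Φ.lastStep w) := fun t ht =>
      hnodup.2.2 _ (List.mem_map_of_mem ht) _ (by simp)
    by_cases hdir : s.2 = (Φ.lastStep w).2
    · exact key s hs (by rw [Prod.ext hw.symm hdir])
    · have hini : L.ini s = L.fin (Φ.lastStep w) := by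
        rcases h1 : s with ⟨e, b⟩
        rcases h2 : Φ.lastStep w with ⟨e', b'⟩
        rw [h1, h2] at hdir hw
        cases b <;> cases b' <;> simp_all [Lattice.ini, Lattice.fin]
      obtain ⟨p, q, hpq⟩ := List.append_of_mem hs
      have hline : Φ.line w = p ++ s :: (q ++ [Φ.lastStep w]) := by
        rw [← hdec, hpq]; simp
      rcases List.eq_nil_or_concat p with rfl | ⟨p', u, rfl⟩
      · have h1 := Φ.anchored w
        simp only [hline, List.nil_append, List.head_cons] at h1
        exact Φ.off_boundary w _ (Φ.lastStep_mem w) (hini ▸ h1)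
      · have h1 := Φ.chain w
        rw [hline, List.isChain_append] at h1
        have h2 : L.fin u = L.ini s := h1.2.2 u (by simp) s (by simp)
        exact key u (by rw [hpq]; simp) (h2.trans hini)
  · exact Φ.edge_disjoint w v hne _ (Φ.lastStep_mem w) _ hsl hw

end ExtrinsicFrame

/-! ### Gauge transformations, physical Hilbert spaces, algebras -/

section Physical

variable (G : Type*) [Group G] [TopologicalSpace G] [IsTopologicalGroup G] [CompactSpace G]
  [T2Space G] [SecondCountableTopology G] [MeasurableSpace G] [BorelSpace G]
  {V E : Type*} [DecidableEq V] [DecidableEq E] [Fintype V] [Fintype E]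
  {L : Lattice V E} (R : Region L)

/-- The component at the vertex `v` of a gauge transformation supported on the vertices `W`. -/
def siteHom (W : Finset V) (v : V) : (↥W → G) →ₜ* G :=
  if h : v ∈ W then ⟨Pi.evalMonoidHom _ ⟨v, h⟩, continuous_apply (⟨v, h⟩ : ↥W)⟩ else 1

/-- The unitary representation of gauge transformations at the vertices `W` on the link variables
of the edges `F`: `|x_e⟩ ↦ |h_{tgt e} x_e h_{src e}⁻¹⟩`. -/
noncomputable def gaugeRep (L : Lattice V E) (W : Finset V) (F : Finset E) :
    UnitaryRep (↥W → G) (LinkSpace G F) :=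
  linkRep (fun e => siteHom G W (L.tgt e)) (fun e => siteHom G W (L.src e))

/-- The bulk vertices that do not lie on the corner. -/
def Region.offCorner (R : Region L) : Finset V := (Finset.univ \ L.boundary) \ R.corner

/-- The states of the links `F` satisfying the Gauss constraints at all bulk vertices off the
corner. For `F` the edges of `Σ` this is `H_Σ^phys`, and for `F` the set of all edges it is
`H_kin^{∂Σ}`. -/
noncomputable def physSpace (F : Finset E) : Submodule ℂ (LinkSpace G F) :=
  (gaugeRep G L R.offCorner F).invariants

variable {G} in
theorem siteHom_commute {W W' : Finset V} (hW : Disjoint W W') (v : V) (h : ↥W → G)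
    (k : ↥W' → G) : Commute (siteHom G W v h) (siteHom G W' v k) := by
  by_cases h1 : v ∈ W
  · have h2 : v ∉ W' := fun h2 => Finset.disjoint_left.1 hW h1 h2
    simp [siteHom, h2]
  · simp [siteHom, h1]

variable {G} in
theorem linkRep_commute {ι Γ Δ : Type*} [Fintype ι] [Group Γ] [TopologicalSpace Γ]
    [IsTopologicalGroup Γ] [Group Δ] [TopologicalSpace Δ] [IsTopologicalGroup Δ]
    (l r : ι → (Γ →ₜ* G)) (l' r' : ι → (Δ →ₜ* G))
    (hl : ∀ i γ δ, Commute (l i γ) (l' i δ)) (hr : ∀ i γ δ, Commute (r i γ) (r' i δ))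
    (γ : Γ) (δ : Δ) (ψ : Lp ℂ 2 (haarPi G ι)) :
    (linkRep l r).toHom γ ((linkRep l' r').toHom δ ψ) =
      (linkRep l' r').toHom δ ((linkRep l r).toHom γ ψ) := by
  simp only [linkRep_apply]
  rw [← Lp.compMeasurePreserving_comp_apply, ← Lp.compMeasurePreserving_comp_apply]
  have : linkAct l' r' δ⁻¹ ∘ linkAct l r γ⁻¹ = linkAct l r γ⁻¹ ∘ linkAct l' r' δ⁻¹ := by
    funext x i
    simp only [linkAct, Function.comp]
    have h1 := (hl i γ⁻¹ δ⁻¹).eq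
    have h2 := (hr i γ⁻¹ δ⁻¹).inv_inv.eq
    calc _ = l' i δ⁻¹ * l i γ⁻¹ * x i * ((r i γ⁻¹)⁻¹ * (r' i δ⁻¹)⁻¹) := by simp only [mul_assoc]
      _ = l i γ⁻¹ * l' i δ⁻¹ * x i * ((r' i δ⁻¹)⁻¹ * (r i γ⁻¹)⁻¹) := by rw [h1, h2]
      _ = _ := by simp only [mul_assoc]
  simp only [this]

instance (F : Finset E) : CompleteSpace (physSpace G R F) := by
  unfold physSpace; infer_instance

theorem Region.disjoint_corner_offCorner : Disjoint R.corner R.offCorner :=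
  Finset.disjoint_sdiff

/-- The representation `U(g_{∂Σ})` of the corner gauge group `𝒢_{∂Σ} = G^{V_{∂Σ}}`. -/
noncomputable def cornerRep (F : Finset E) : UnitaryRep (↥R.corner → G) (physSpace G R F) :=
  (gaugeRep G L R.corner F).restrict _ fun γ ψ hψ δ => by
    have h := linkRep_commute (fun e : ↥F => siteHom G R.corner (L.tgt e))
      (fun e => siteHom G R.corner (L.src e)) (fun e => siteHom G R.offCorner (L.tgt e))
      (fun e => siteHom G R.offCorner (L.src e))
      (fun _ _ _ => siteHom_commute R.disjoint_corner_offCorner _ _ _)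
      (fun _ _ _ => siteHom_commute R.disjoint_corner_offCorner _ _ _) γ δ ψ
    change (gaugeRep G L R.corner F).toHom γ ((gaugeRep G L R.offCorner F).toHom δ ψ) = _ at h
    rw [hψ δ] at h
    exact h.symm

/-- The coherent average `Π_{∂Σ}^phys = ∫ dg U(g)` over the corner gauge group, on
`H_kin^{∂Σ}`. -/
noncomputable def cornerProj :
    physSpace G R Finset.univ →L[ℂ] physSpace G R Finset.univ :=
  (cornerRep G R Finset.univ).average (haarPi G ↥R.corner)

/-! #### The regional algebra -/

/-- `ψ = f ⊗ k`, where `f` depends on the links `F₁ ⊆ F` and `k` on the remaining ones. -/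
def IsProduct {F₁ F : Finset E} (hF : F₁ ⊆ F) (f : LinkSpace G F₁) (k : LinkSpace G (F \ F₁))
    (ψ : LinkSpace G F) : Prop :=
  ∀ᵐ x ∂haarPi G F, ψ x =
    f (Finset.restrict₂ (π := fun _ => G) hF x) *
      k (Finset.restrict₂ (π := fun _ => G) Finset.sdiff_subset x)

/-- `A = a ⊗ 1`, for an operator `a` on the physical states of the links `F₁ ⊆ F`. -/
def IsAmpliation {F₁ F : Finset E} (hF : F₁ ⊆ F)
    (a : physSpace G R F₁ →L[ℂ] physSpace G R F₁)
    (A : physSpace G R F →L[ℂ] physSpace G R F) : Prop :=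
  ∀ (f : physSpace G R F₁) (k : physSpace G R (F \ F₁)) (ψ : physSpace G R F),
    IsProduct G hF f k ψ → IsProduct G hF (a f) k (A ψ)

/-- The algebra `𝒜_Σ = B(H_Σ^phys)` of the region `Σ`, acting as `B(H_Σ^phys) ⊗ 1` on the physical
states of the links `F ⊇ Σ`. The factorisation of the links in `∂Σ` into an intrinsic frame and the
rest only changes variables inside `H_Σ^phys`. -/
def regionAlgebra (F : Finset E) (hF : R.edges ⊆ F) :
    Set (physSpace G R F →L[ℂ] physSpace G R F) :=
  {A | ∃ a : physSpace G R R.edges →L[ℂ] physSpace G R R.edges, IsAmpliation G R hF a A}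

/-- The subalgebra `𝒜_Σ^{𝒢_{∂Σ}}` of `𝒢_{∂Σ}`-invariant elements of `𝒜_Σ`, on `H_kin^{∂Σ}`. -/
def invariantRegionAlgebra :
    Set (physSpace G R Finset.univ →L[ℂ] physSpace G R Finset.univ) :=
  {A | A ∈ regionAlgebra G R Finset.univ (Finset.subset_univ _) ∧
    ∀ g, (cornerRep G R Finset.univ).op g ∘L A = A ∘L (cornerRep G R Finset.univ).op g}

/-- The electric center algebra `𝒜_E = Π 𝒜_Σ Π` with `Π = Π_{∂Σ}^phys`. -/
noncomputable def electricCenterAlgebra :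
    Set (physSpace G R Finset.univ →L[ℂ] physSpace G R Finset.univ) :=
  (fun A => cornerProj G R ∘L A ∘L cornerProj G R) ''
    regionAlgebra G R Finset.univ (Finset.subset_univ _)

/-! #### Extrinsic frames: reorientations, reduction and relational algebras -/

namespace ExtrinsicFrame

variable {R} (Φ : ExtrinsicFrame R)

open Classical in
/-- The component `h ↦ h_v` at the corner vertex `v` whose marked step is `s` (and `1` if `s` is
not a marked step). -/
noncomputable def markHom (m : ↥R.corner → Lattice.Step E) (s : Lattice.Step E) :
    (↥R.corner → G) →ₜ* G :=
  if h : ∃ v, m v = s then ⟨Pi.evalMonoidHom _ h.choose, continuous_apply h.choose⟩ else 1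

/-- The reorientations `V_Φ(h)` on `H_kin`: they act on the edges of the Wilson lines incident on
the global boundary, by right multiplication with `h_v⁻¹` (by left multiplication with `h_v` if the
edge is oriented opposite to the Wilson line). -/
noncomputable def reorientKin : UnitaryRep (↥R.corner → G) (LinkSpace G (Finset.univ : Finset E)) :=
  linkRep (fun e => markHom G Φ.firstStep (e, false)) (fun e => markHom G Φ.firstStep (e, true))

variable {G} in
theorem markHom_commute (s : Lattice.Step E) (h : ↥R.corner → G) (k : ↥R.offCorner → G) :
    Commute (markHom G Φ.firstStep s h) (siteHom G R.offCorner (L.ini s) k) := by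
  by_cases hs : ∃ v, Φ.firstStep v = s
  · obtain ⟨v, rfl⟩ := hs
    have : L.ini (Φ.firstStep v) ∉ R.offCorner := fun hmem => by
      simp only [Region.offCorner, Finset.mem_sdiff] at hmem
      exact hmem.1.2 (Φ.anchored v)
    simp [siteHom, this]
  · simp [markHom, hs]

/-- The reorientations `V_Φ(h)` on `H_kin^{∂Σ}`. -/
noncomputable def reorientRep :
    UnitaryRep (↥R.corner → G) (physSpace G R (Finset.univ : Finset E)) :=
  (Φ.reorientKin G).restrict _ fun γ ψ hψ δ => by
    have h := linkRep_commute (fun e : ↥(Finset.univ : Finset E) =>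
        markHom G Φ.firstStep ((e : E), false))
      (fun e => markHom G Φ.firstStep ((e : E), true))
      (fun e => siteHom G R.offCorner (L.tgt e))
      (fun e => siteHom G R.offCorner (L.src e))
      (fun e γ δ => Φ.markHom_commute (e, false) γ δ)
      (fun e γ δ => Φ.markHom_commute (e, true) γ δ) γ δ ψ
    change (Φ.reorientKin G).toHom γ ((gaugeRep G L R.offCorner Finset.univ).toHom δ ψ) = _ at h
    rw [hψ δ] at h
    exact h.symm

variable {G}

/-- The parallel transport along a step. -/
def stepVal (x : ↥(Finset.univ : Finset E) → G) (s : Lattice.Step E) : G :=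
  if s.2 then x ⟨s.1, Finset.mem_univ _⟩ else (x ⟨s.1, Finset.mem_univ _⟩)⁻¹

/-- The path-ordered product `g_n ⋯ g_2 g_1` along a sequence of steps. -/
def holonomy (x : ↥(Finset.univ : Finset E) → G) : List (Lattice.Step E) → G
  | [] => 1
  | s :: t => holonomy x t * stepVal x s

/-- The orientation of the frame `Φ` in the configuration `x`: the holonomies of its Wilson
lines. -/
def orientation (x : ↥(Finset.univ : Finset E) → G) : ↥R.corner → G :=
  fun v => holonomy x (Φ.line v)

/-- The links of the system `S`, the complement of the frame `Φ`. The coordinates on configuration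
space adapted to `Φ` are the orientation of `Φ` and the links that are not last edges of its Wilson
lines (for the remaining edges of the Wilson lines the link variables carry the same information as
the holonomies up to intermediate vertices). -/
def systemEdges : Finset E := Finset.univ \ Φ.lastEdges

theorem edges_subset_systemEdges : R.edges ⊆ Φ.systemEdges := by
  intro e he
  simp only [systemEdges, Finset.mem_sdiff, Finset.mem_univ, true_and, lastEdges,
    Finset.mem_image, not_exists]
  rintro v rfl
  exact Φ.extrinsic v _ (Φ.lastStep_mem v) he

/-- The corner gauge transformation bringing the configuration `x` to the one where `Φ` has
orientation `g`. -/
def fixing (g : ↥R.corner → G) (x : ↥(Finset.univ : Finset E) → G) : ↥R.corner → G :=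
  g * (Φ.orientation x)⁻¹

/-- The configuration of `S` in the gauge where `Φ` has orientation `g`. -/
noncomputable def gaugeFix (g : ↥R.corner → G) (x : ↥(Finset.univ : Finset E) → G) :
    ↥Φ.systemEdges → G :=
  linkAct (fun e : ↥Φ.systemEdges => siteHom G R.corner (L.tgt e))
    (fun e => siteHom G R.corner (L.src e)) (Φ.fixing g x)
    (Finset.restrict₂ (π := fun _ => G) (Finset.subset_univ _) x)

theorem continuous_stepVal (s : Lattice.Step E) :
    Continuous fun x : ↥(Finset.univ : Finset E) → G => stepVal x s := by
  unfold stepVal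
  split
  · exact continuous_apply _
  · exact (continuous_apply _).inv

theorem continuous_holonomy (p : List (Lattice.Step E)) :
    Continuous fun x : ↥(Finset.univ : Finset E) → G => holonomy x p := by
  induction p with
  | nil => exact continuous_const
  | cons s t ih => exact ih.mul (continuous_stepVal s)

theorem continuous_orientation :
    Continuous fun x : ↥(Finset.univ : Finset E) → G => Φ.orientation x :=
  continuous_pi fun v => continuous_holonomy (Φ.line v)

theorem holonomy_append (x : ↥(Finset.univ : Finset E) → G) (p q : List (Lattice.Step E)) :
    holonomy x (p ++ q) = holonomy x q * holonomy x p := by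
  induction p with
  | nil => simp [holonomy]
  | cons s t ih => simp [holonomy, ih, mul_assoc]

theorem holonomy_congr {x y : ↥(Finset.univ : Finset E) → G} {p : List (Lattice.Step E)}
    (h : ∀ s ∈ p, x ⟨s.1, Finset.mem_univ _⟩ = y ⟨s.1, Finset.mem_univ _⟩) :
    holonomy x p = holonomy y p := by
  induction p with
  | nil => rfl
  | cons s t ih =>
    simp only [holonomy]
    rw [ih fun u hu => h u (List.mem_cons_of_mem _ hu)]
    simp only [stepVal, h s List.mem_cons_self]

/-- Gauge transformations act on a holonomy at its two endpoints. -/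
theorem holonomy_gauge (W : Finset V) (h : ↥W → G) (x : ↥(Finset.univ : Finset E) → G)
    (p : List (Lattice.Step E)) (hp : p ≠ []) (hc : p.IsChain fun s t => L.fin s = L.ini t) :
    holonomy (linkAct (fun e : ↥(Finset.univ : Finset E) => siteHom G W (L.tgt e))
      (fun e => siteHom G W (L.src e)) h x) p =
      siteHom G W (L.fin (p.getLast hp)) h * holonomy x p *
        (siteHom G W (L.ini (p.head hp)) h)⁻¹ := by
  have hstep : ∀ s : Lattice.Step E,
      stepVal (linkAct (fun e : ↥(Finset.univ : Finset E) => siteHom G W (L.tgt e))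
        (fun e => siteHom G W (L.src e)) h x) s =
      siteHom G W (L.fin s) h * stepVal x s * (siteHom G W (L.ini s) h)⁻¹ := by
    rintro ⟨e, b⟩
    cases b <;> simp [stepVal, linkAct, Lattice.fin, Lattice.ini, mul_assoc]
  induction p with
  | nil => exact absurd rfl hp
  | cons s t ih =>
    rcases t with _ | ⟨u, t⟩
    · simp [holonomy, hstep]
    · have hc' := List.isChain_cons_cons.1 hc
      have := ih (by simp) hc'.2
      rw [holonomy, this, hstep, holonomy.eq_2 x s]
      simp [hc'.1, mul_assoc]

theorem measurePreserving_restrict₂ {F F' : Finset E} (h : F ⊆ F') :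
    MeasurePreserving (Finset.restrict₂ (π := fun _ => G) h) (haarPi G F') (haarPi G F) := by
  have hmeas : Measurable (Finset.restrict₂ (π := fun _ => G) h) :=
    Finset.measurable_restrict₂ h
  refine ⟨hmeas, ?_⟩
  symm
  refine Measure.pi_eq fun s hs => ?_
  rw [Measure.map_apply hmeas (MeasurableSet.univ_pi hs)]
  have : Finset.restrict₂ (π := fun _ => G) h ⁻¹' Set.univ.pi s =
      Set.univ.pi fun e : ↥F' => if he : (e : E) ∈ F then s ⟨e, he⟩ else Set.univ := by
    ext x
    simp only [Set.mem_preimage, Set.mem_univ_pi]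
    constructor
    · rintro hx ⟨e, he'⟩
      by_cases he : e ∈ F
      · simpa [he] using hx ⟨e, he⟩
      · simp [he]
    · rintro hx ⟨e, he⟩
      simpa [he] using hx ⟨e, h he⟩
  rw [this, Measure.pi_pi]
  have h2 : ∀ e : ↥F', haarProb G (if he : (e : E) ∈ F then s ⟨e, he⟩ else Set.univ) =
      (fun e : E => if he : e ∈ F then haarProb G (s ⟨e, he⟩) else 1) e := by
    intro e
    by_cases he : (e : E) ∈ F <;> simp [he]
  rw [Finset.prod_congr rfl fun e _ => h2 e, Finset.prod_coe_sort F'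
    (fun e : E => if he : e ∈ F then haarProb G (s ⟨e, he⟩) else 1),
    ← Finset.prod_subset h (fun e _ he => by simp [he]), ← Finset.prod_coe_sort F]
  exact Finset.prod_congr rfl fun e _ => by simp

theorem markHom_of_eq {m : ↥R.corner → Lattice.Step E} (hm : Function.Injective m)
    (v : ↥R.corner) (h : ↥R.corner → G) : markHom G m (m v) h = h v := by
  have hex : ∃ w, m w = m v := ⟨v, rfl⟩
  have : hex.choose = v := hm hex.choose_spec
  simp only [markHom, hex, dite_true, this]
  rfl

/-- Left multiplication of the frame orientation by `h`, acting on the last edges only. -/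
noncomputable def lastAct (h : ↥R.corner → G) (x : ↥(Finset.univ : Finset E) → G) :
    ↥(Finset.univ : Finset E) → G :=
  linkAct (fun e : ↥(Finset.univ : Finset E) => markHom G Φ.lastStep ((e : E), true))
    (fun e => markHom G Φ.lastStep ((e : E), false)) h x

theorem lastAct_of_notMem (h : ↥R.corner → G) (x : ↥(Finset.univ : Finset E) → G)
    (e : ↥(Finset.univ : Finset E)) (he : (e : E) ∉ Φ.lastEdges) : Φ.lastAct h x e = x e := by
  have : ∀ b, ¬ ∃ v, Φ.lastStep v = ((e : E), b) := by
    rintro b ⟨v, hv⟩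
    exact he (Finset.mem_image.2 ⟨v, Finset.mem_univ _, by rw [hv]⟩)
  simp [lastAct, linkAct, markHom, this]

theorem orientation_lastAct (h : ↥R.corner → G) (x : ↥(Finset.univ : Finset E) → G) :
    Φ.orientation (Φ.lastAct h x) = h * Φ.orientation x := by
  funext v
  have hdec : (Φ.line v).dropLast ++ [Φ.lastStep v] = Φ.line v :=
    List.dropLast_append_getLast (Φ.ne_nil v)
  have hinj : Function.Injective Φ.lastStep := fun v w hvw =>
    Φ.lastStep_injective (congrArg Prod.fst hvw)
  have hlast : stepVal (Φ.lastAct h x) (Φ.lastStep v) = h v * stepVal x (Φ.lastStep v) := by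
    have h1 := markHom_of_eq (G := G) hinj v h
    have h2 : ∀ b, b ≠ (Φ.lastStep v).2 →
        markHom G Φ.lastStep ((Φ.lastStep v).1, b) h = 1 := by
      intro b hb
      have : ¬ ∃ w, Φ.lastStep w = ((Φ.lastStep v).1, b) := by
        rintro ⟨w, hw⟩
        have : w = v := Φ.lastStep_injective (by rw [hw])
        subst this
        exact hb (by rw [hw])
      simp [markHom, this]
    rcases hs : Φ.lastStep v with ⟨e, b⟩
    rw [hs] at h1 h2
    cases b
    · have h3 := h2 true (by simp)
      simp only at h3
      simp [stepVal, lastAct, linkAct, h1, h3]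
    · have h3 := h2 false (by simp)
      simp only at h3
      simp [stepVal, lastAct, linkAct, h1, h3]
  simp only [orientation, Pi.mul_apply]
  rw [← hdec, holonomy_append, holonomy_append]
  simp only [holonomy, one_mul]
  rw [hlast, mul_assoc]
  congr 2
  exact holonomy_congr fun s hs => Φ.lastAct_of_notMem h x _ (Φ.fst_notMem_lastEdges hs)

theorem continuous_gaugeFix (g : ↥R.corner → G) : Continuous (Φ.gaugeFix g) := by
  have h1 : Continuous (Φ.fixing g) := continuous_const.mul Φ.continuous_orientation.inv
  have h2 : Continuous (Finset.restrict₂ (π := fun _ => G)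
      (Finset.subset_univ Φ.systemEdges)) := continuous_pi fun e => continuous_apply _
  exact (continuous_linkAct _ _).comp (h1.prodMk h2)

theorem measurePreserving_gaugeFix (g : ↥R.corner → G) :
    MeasurePreserving (Φ.gaugeFix g) (haarPi G (Finset.univ : Finset E))
      (haarPi G Φ.systemEdges) := by
  set μ := haarPi G (Finset.univ : Finset E)
  set ν := haarPi G Φ.systemEdges
  set ρ := haarPi G ↥R.corner
  have hsnd : MeasurePreserving Prod.snd (ρ.prod μ) μ := measurePreserving_snd
  have hlast : MeasurePreserving (fun p : (↥R.corner → G) × _ => Φ.lastAct p.1⁻¹ p.2)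
      (ρ.prod μ) μ :=
    hsnd.comp ((MeasurePreserving.id ρ).skew_product (g := fun h x => Φ.lastAct h⁻¹ x)
      ((continuous_linkAct _ _).comp
        (continuous_fst.inv.prodMk continuous_snd)).measurable
      (Filter.Eventually.of_forall fun h => (measurePreserving_linkAct _ _ h⁻¹).map_eq))
  have hact : MeasurePreserving (fun p : (↥R.corner → G) × (↥Φ.systemEdges → G) =>
      linkAct (fun e : ↥Φ.systemEdges => siteHom G R.corner (L.tgt e))
        (fun e => siteHom G R.corner (L.src e)) p.1 p.2) (ρ.prod ν) ν :=
    measurePreserving_snd.comp ((MeasurePreserving.id ρ).skew_product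
      (g := fun h x => linkAct (fun e : ↥Φ.systemEdges => siteHom G R.corner (L.tgt e))
        (fun e => siteHom G R.corner (L.src e)) h x)
      (continuous_linkAct _ _).measurable
      (Filter.Eventually.of_forall fun h => (measurePreserving_linkAct _ _ h).map_eq))
  have hfix : MeasurePreserving (fun p : (↥R.corner → G) × (↥(Finset.univ : Finset E) → G) =>
      (g * (Φ.orientation p.2)⁻¹ * p.1,
        Finset.restrict₂ (π := fun _ => G) (Finset.subset_univ Φ.systemEdges) p.2))
      (ρ.prod μ) (ρ.prod ν) := by
    have h1 := (measurePreserving_restrict₂ (G := G)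
      (Finset.subset_univ Φ.systemEdges)).skew_product (μc := ρ) (μd := ρ)
      (g := fun x h => g * (Φ.orientation x)⁻¹ * h)
      ((continuous_const.mul (Φ.continuous_orientation.comp continuous_fst).inv).mul
        continuous_snd).measurable
      (Filter.Eventually.of_forall fun x => map_mul_left_eq_self ρ _)
    exact (Measure.measurePreserving_swap.comp h1).comp Measure.measurePreserving_swap
  have hcomp : (Φ.gaugeFix g ∘ fun p : (↥R.corner → G) × _ => Φ.lastAct p.1⁻¹ p.2) =
      (fun p : (↥R.corner → G) × (↥Φ.systemEdges → G) =>
        linkAct (fun e : ↥Φ.systemEdges => siteHom G R.corner (L.tgt e))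
          (fun e => siteHom G R.corner (L.src e)) p.1 p.2) ∘
      fun p : (↥R.corner → G) × (↥(Finset.univ : Finset E) → G) =>
        (g * (Φ.orientation p.2)⁻¹ * p.1,
          Finset.restrict₂ (π := fun _ => G) (Finset.subset_univ Φ.systemEdges) p.2) := by
    funext p
    have h1 : Φ.fixing g (Φ.lastAct p.1⁻¹ p.2) = g * (Φ.orientation p.2)⁻¹ * p.1 := by
      simp [fixing, orientation_lastAct, mul_assoc]
    have h2 : Finset.restrict₂ (π := fun _ => G) (Finset.subset_univ Φ.systemEdges)
        (Φ.lastAct p.1⁻¹ p.2) =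
        Finset.restrict₂ (π := fun _ => G) (Finset.subset_univ Φ.systemEdges) p.2 := by
      funext e
      exact Φ.lastAct_of_notMem _ _ _ (Finset.mem_sdiff.1 e.2).2
    simp only [Function.comp, gaugeFix, h1, h2]
  refine ⟨(Φ.continuous_gaugeFix g).measurable, ?_⟩
  calc μ.map (Φ.gaugeFix g)
      = ((ρ.prod μ).map fun p => Φ.lastAct p.1⁻¹ p.2).map (Φ.gaugeFix g) := by rw [hlast.map_eq]
    _ = (ρ.prod μ).map (Φ.gaugeFix g ∘ fun p => Φ.lastAct p.1⁻¹ p.2) :=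
        Measure.map_map (Φ.continuous_gaugeFix g).measurable hlast.measurable
    _ = ν := by rw [hcomp]; exact (hact.comp hfix).map_eq

/-- Gauge fixing is equivariant for gauge transformations off the corner. -/
theorem gaugeFix_gauge (g : ↥R.corner → G) (h : ↥R.offCorner → G)
    (x : ↥(Finset.univ : Finset E) → G) :
    Φ.gaugeFix g (linkAct (fun e : ↥(Finset.univ : Finset E) => siteHom G R.offCorner (L.tgt e))
      (fun e => siteHom G R.offCorner (L.src e)) h x) =
    linkAct (fun e : ↥Φ.systemEdges => siteHom G R.offCorner (L.tgt e))
      (fun e => siteHom G R.offCorner (L.src e)) h (Φ.gaugeFix g x) := by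
  have h1 : Φ.orientation (linkAct (fun e : ↥(Finset.univ : Finset E) =>
      siteHom G R.offCorner (L.tgt e)) (fun e => siteHom G R.offCorner (L.src e)) h x) =
      Φ.orientation x := by
    funext v
    have h2 : L.fin ((Φ.line v).getLast (Φ.ne_nil v)) ∉ R.offCorner := by
      rw [Φ.reaches v]
      exact fun hm => Finset.disjoint_left.1 R.disjoint_corner_offCorner v.2 hm
    have h3 : L.ini ((Φ.line v).head (Φ.ne_nil v)) ∉ R.offCorner := fun hm => by
      simp only [Region.offCorner, Finset.mem_sdiff] at hm
      exact hm.1.2 (Φ.anchored v)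
    rw [orientation, holonomy_gauge _ _ _ _ (Φ.ne_nil v) (Φ.chain v)]
    simp [siteHom, h2, h3, orientation]
  have h4 : Φ.fixing g (linkAct (fun e : ↥(Finset.univ : Finset E) =>
      siteHom G R.offCorner (L.tgt e)) (fun e => siteHom G R.offCorner (L.src e)) h x) =
      Φ.fixing g x := by rw [fixing, h1, fixing]
  funext e
  have hl := (siteHom_commute R.disjoint_corner_offCorner (L.tgt e) (Φ.fixing g x) h).eq
  have hr := (siteHom_commute R.disjoint_corner_offCorner (L.src e)
    (Φ.fixing g x) h).inv_inv.eq
  simp only [gaugeFix, h4, linkAct, Finset.restrict₂]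
  rw [← mul_assoc, ← mul_assoc, hl, mul_assoc _ _ (siteHom G R.corner (L.src e) _)⁻¹, ← hr]
  simp only [mul_assoc]

variable (G)

/-- The adjoint `R_Φ(g)† = Π (|g⟩_Φ ⊗ 1)` of the reduction map: it maps a state `f` of the system
`S` to the physical state `ψ` with `⟨g|_Φ ψ = f`, namely to `ψ(x) = f(x')`, where `x'` is the
configuration of `S` after the corner gauge transformation of `x` that brings the frame `Φ` to the
orientation `g`. It is a linear isometry into `H_kin^{∂Σ}`. -/
noncomputable def reductionAdj (g : ↥R.corner → G) :
    physSpace G R Φ.systemEdges →ₗᵢ[ℂ] physSpace G R (Finset.univ : Finset E) where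
  toFun f := ⟨Lp.compMeasurePreservingₗᵢ ℂ (Φ.gaugeFix g) (Φ.measurePreserving_gaugeFix g) f,
    fun h => by
      have hf := f.2 h
      change Lp.compMeasurePreserving _ _ (Lp.compMeasurePreserving _ _ _) =
        Lp.compMeasurePreserving _ _ _
      change Lp.compMeasurePreserving _ _ _ = _ at hf
      rw [← Lp.compMeasurePreserving_comp_apply]
      conv_rhs => rw [← hf, ← Lp.compMeasurePreserving_comp_apply]
      congr 2
      funext x
      exact Φ.gaugeFix_gauge g h⁻¹ x⟩
  map_add' a b := by ext1; simp
  map_smul' c a := by ext1; simp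
  norm_map' a := by simp

/-- The Page-Wootters reduction map `R_Φ(g) = ⟨g|_Φ ⊗ 1`, extended by zero to the orthogonal
complement of the physical Hilbert space. -/
noncomputable def reduction (g : ↥R.corner → G) :
    physSpace G R (Finset.univ : Finset E) →L[ℂ] physSpace G R Φ.systemEdges :=
  ContinuousLinearMap.adjoint (Φ.reductionAdj G g).toContinuousLinearMap

/-- The extrinsic relational algebra `𝒜_{Σ|Φ}^phys = R_Φ(g)† 𝒜_Σ R_Φ(g)` of the region `Σ` relative
to the frame `Φ` in orientation `g`. -/
noncomputable def relationalAlgebra (g : ↥R.corner → G) :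
    Set (physSpace G R (Finset.univ : Finset E) →L[ℂ] physSpace G R (Finset.univ : Finset E)) :=
  (fun A => (Φ.reductionAdj G g).toContinuousLinearMap ∘L A ∘L Φ.reduction G g) ''
    regionAlgebra G R Φ.systemEdges Φ.edges_subset_systemEdges

/-- The twirl `𝔾_{∂Σ}(O) = ∫ dh V_Φ(h) O V_Φ(h)†` over the reorientation group of `Φ`. -/
noncomputable def reorientationTwirl
    (O : physSpace G R (Finset.univ : Finset E) →L[ℂ] physSpace G R (Finset.univ : Finset E)) :
    physSpace G R (Finset.univ : Finset E) →L[ℂ] physSpace G R (Finset.univ : Finset E) :=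
  (Φ.reorientRep G).twirl (haarPi G ↥R.corner) O

end ExtrinsicFrame

end Physical

end LatticeGauge

/-! Write R(g) for the reduction map of a frame Φ with system links S. Its adjoint R(g)† is an
isometry from system states onto the corner-invariant states, so R(g)†R(g) = Π. Three facts about it
carry the theorem.

(1) Corner gauge transformations multiply the orientation of Φ on the left, reorientations multiply
it on the right. Gauge fixing to orientation g therefore turns V_Φ(h) into the corner gauge
transformation U(g h g⁻¹) of S, up to a residual reorientation that touches only links outside Σ and
so commutes with 𝒜_Σ. By conjugation invariance of Haar measure, twirling R†AR over reorientations
gives R†(corner twirl of A)R: `reorientationTwirl_relationalOp`.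

(2) If b is corner invariant, R† intertwines b ⊗ 1 on S with b ⊗ 1 on all links
(`isAmpliation_reductionAdj`). Formally R(k)†f = Π(|k⟩ ⊗ f), and b ⊗ 1 commutes both with Π and with
attaching a frame state, since the frame avoids Σ. The kets |k⟩ are not normalisable in general, so
they are smeared with continuous wave functions m, and the smearing is removed at the end by
continuity in k. Hence R†(twirl A)R = (twirl A')R†R = (twirl A')Π = ΠA'Π, where A and A' are
ampliations of one operator a: `relationalOp_twirl`. With (1) this identifies the reorientation
twirl of every relational algebra with 𝒜_E. As twirl A is itself an ampliation, it also places 𝒜_E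
inside every relational algebra.

(3) If Φ' does not overlap Φ, its reorientations do not change the orientation of Φ, so no corner
transformation arises and they fix every relational operator of Φ. An operator O in both algebras
therefore equals its own Φ'-twirl, and that twirl lies in 𝒜_E.

The analytic groundwork is that product vectors are total. Stone–Weierstrass gives this on L², and
group averaging transfers it to the states obeying the Gauss constraints. It makes ampliations exist
and be determined by their values on products. -/

namespace LatticeGauge

open scoped TensorProduct InnerProductSpace ENNReal ComplexConjugate

/-! ### Total sets of product vectors and ampliations a ⊗ 1 -/

section Hilbert

variable {H₁ H₂ H K : Type*} [NormedAddCommGroup H₁] [InnerProductSpace ℂ H₁]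
  [NormedAddCommGroup H₂] [InnerProductSpace ℂ H₂] [NormedAddCommGroup H] [InnerProductSpace ℂ H]
  [NormedAddCommGroup K] [InnerProductSpace ℂ K] [CompleteSpace H] [CompleteSpace K]

/-- Operators that agree on a total set of product vectors are equal. -/
theorem clm_ext_of_total {B : H₁ → H₂ → H} (hB : ∀ ψ, (∀ f k, ⟪ψ, B f k⟫_ℂ = 0) → ψ = 0)
    {A A' : H →L[ℂ] K} (h : ∀ f k, A (B f k) = A' (B f k)) : A = A' := by
  rw [← sub_eq_zero, ← ContinuousLinearMap.adjoint.map_eq_zero_iff]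
  ext φ
  refine hB _ fun f k => ?_
  rw [ContinuousLinearMap.adjoint_inner_left]
  simp [h f k]

/-- Existence of `a ⊗ 1`. -/
theorem exists_ampliation (B : H₁ →L[ℂ] H₂ →L[ℂ] H)
    (hi : ∀ f f' k k', ⟪B f k, B f' k'⟫_ℂ = ⟪f, f'⟫_ℂ * ⟪k, k'⟫_ℂ)
    (hB : ∀ ψ, (∀ f k, ⟪ψ, B f k⟫_ℂ = 0) → ψ = 0) (a : H₁ →L[ℂ] H₁) :
    ∃ A : H →L[ℂ] H, ∀ f k, A (B f k) = B (a f) k := by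
  let e : H₁ ⊗[ℂ] H₂ →ₗ[ℂ] H := TensorProduct.lift B.toLinearMap₁₂
  have he : ∀ f k, e (f ⊗ₜ k) = B f k := fun f k => by simp [e]
  have hin : ∀ x y, ⟪e x, e y⟫_ℂ = ⟪x, y⟫_ℂ := by
    intro x y
    induction x with
    | zero => simp
    | add x₁ x₂ h₁ h₂ => rw [map_add, inner_add_left, inner_add_left, h₁, h₂]
    | tmul f k =>
      induction y with
      | zero => simp
      | add y₁ y₂ h₁ h₂ => rw [map_add, inner_add_right, inner_add_right, h₁, h₂]
      | tmul f' k' => rw [he, he, hi, TensorProduct.inner_tmul]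
  have hnorm : ∀ x, ‖e x‖ = ‖x‖ := fun x => by
    rw [norm_eq_sqrt_re_inner (𝕜 := ℂ), hin]
    exact (norm_eq_sqrt_re_inner (𝕜 := ℂ) x).symm
  have hd : DenseRange e := by
    have : (LinearMap.range e).topologicalClosure = ⊤ := by
      rw [Submodule.topologicalClosure_eq_top_iff, Submodule.eq_bot_iff]
      intro ψ hψ
      refine hB ψ fun f k => ?_
      rw [← he, ← inner_conj_symm, hψ _ ⟨_, rfl⟩, map_zero]
    have h2 := (Submodule.dense_iff_topologicalClosure_eq_top).2 this
    rwa [LinearMap.coe_range] at h2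
  -- `e` embeds the algebraic tensor product isometrically with dense range, and a ⊗ 1 is bounded
  -- there by ‖a‖, so it extends to `H`.
  refine ⟨(e ∘ₗ (a.rTensor H₂).toLinearMap).extendOfNorm e, fun f k => ?_⟩
  rw [← he, LinearMap.extendOfNorm_eq hd ⟨‖a‖, fun x => ?_⟩]
  · simp [he]
  · rw [hnorm]
    change ‖e _‖ ≤ _
    rw [hnorm]
    exact ((a.rTensor H₂).le_opNorm x).trans
      (mul_le_mul_of_nonneg_right (ContinuousLinearMap.norm_rTensor_le _ a) (norm_nonneg _))

end Hilbert

/-! ### Averages and twirls of unitary representations -/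

namespace UnitaryRep

variable {Γ H K : Type*} [Group Γ] [TopologicalSpace Γ] [NormedAddCommGroup H]
  [InnerProductSpace ℂ H] [NormedAddCommGroup K] [InnerProductSpace ℂ K]
  (U : UnitaryRep Γ H)

@[simp] theorem toHom_inv_toHom (γ : Γ) (ψ : H) : U.toHom γ⁻¹ (U.toHom γ ψ) = ψ := by
  rw [map_inv]; exact (U.toHom γ).symm_apply_apply ψ

@[simp] theorem toHom_toHom_inv (γ : Γ) (ψ : H) : U.toHom γ (U.toHom γ⁻¹ ψ) = ψ := by
  rw [map_inv]; exact (U.toHom γ).apply_symm_apply ψ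

theorem toHom_mul (γ δ : Γ) (ψ : H) : U.toHom (γ * δ) ψ = U.toHom γ (U.toHom δ ψ) := by
  rw [map_mul]; rfl

theorem inner_toHom_left (γ : Γ) (ψ φ : H) : ⟪U.toHom γ ψ, φ⟫_ℂ = ⟪ψ, U.toHom γ⁻¹ φ⟫_ℂ := by
  rw [← (U.toHom γ).inner_map_map ψ, toHom_toHom_inv]

theorem inner_toHom_of_mem_invariants {ψ : H} (hψ : ψ ∈ U.invariants) (γ : Γ) (φ : H) :
    ⟪ψ, U.toHom γ φ⟫_ℂ = ⟪ψ, φ⟫_ℂ := by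
  conv_lhs => rw [← hψ γ]
  exact (U.toHom γ).inner_map_map ψ φ

variable [IsTopologicalGroup Γ] [CompactSpace Γ] [MeasurableSpace Γ] [BorelSpace Γ]
  [CompleteSpace H] [CompleteSpace K] (μ : Measure Γ) [IsProbabilityMeasure μ]

theorem map_average (D : H →L[ℂ] K) (ψ : H) :
    D (U.average μ ψ) = ∫ γ, D (U.toHom γ ψ) ∂μ := by
  rw [average_apply, ← ContinuousLinearMap.integral_comp_comm _
    (integrable_of_continuous μ (U.cont ψ))]

theorem map_twirl (D : H →L[ℂ] K) (O : H →L[ℂ] H) (ψ : H) :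
    D (U.twirl μ O ψ) = ∫ γ, D (U.toHom γ (O (U.toHom γ⁻¹ ψ))) ∂μ := by
  rw [twirl_apply, ← ContinuousLinearMap.integral_comp_comm _
    (integrable_of_continuous μ (U.continuous_conj O ψ))]

theorem average_of_mem_invariants {ψ : H} (hψ : ψ ∈ U.invariants) : U.average μ ψ = ψ := by
  simp [average_apply, U.mem_invariants.1 hψ]

theorem inner_average_of_mem_invariants {ψ : H} (hψ : ψ ∈ U.invariants) (φ : H) :
    ⟪ψ, U.average μ φ⟫_ℂ = ⟪ψ, φ⟫_ℂ := by
  have := U.map_average μ (innerSL ℂ ψ) φ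
  simpa [inner_toHom_of_mem_invariants U hψ] using this

theorem average_comp_comm {A : H →L[ℂ] H} (hA : ∀ γ ψ, U.toHom γ (A ψ) = A (U.toHom γ ψ)) (ψ : H) :
    U.average μ (A ψ) = A (U.average μ ψ) := by
  rw [map_average, average_apply]
  simp only [hA]

variable [μ.IsMulLeftInvariant]

theorem average_mem_invariants (ψ : H) : U.average μ ψ ∈ U.invariants := by
  intro γ
  have h := U.map_average μ (U.op γ) ψ
  simp only [op_apply, ← toHom_mul] at h
  rw [h, integral_mul_left_eq_self (fun δ => U.toHom δ ψ) γ, average_apply]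

theorem toHom_twirl (O : H →L[ℂ] H) (γ : Γ) (ψ : H) :
    U.toHom γ (U.twirl μ O ψ) = U.twirl μ O (U.toHom γ ψ) := by
  have h := U.map_twirl μ (U.op γ) O ψ
  simp only [op_apply, ← toHom_mul] at h
  rw [h, twirl_apply,
    ← integral_mul_left_eq_self (fun δ => U.toHom δ (O (U.toHom δ⁻¹ (U.toHom γ ψ)))) γ]
  simp only [mul_inv_rev, toHom_mul, toHom_inv_toHom]

/-- The inner average is an invariant vector, so a factor U(γ⁻¹) can be inserted in front of it,
turning the outer average into a conjugation. -/
theorem average_conj (O : H →L[ℂ] H) (ψ : H) :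
    U.average μ (O (U.average μ ψ)) = U.twirl μ O (U.average μ ψ) := by
  rw [average_apply, twirl_apply]
  exact integral_congr_ae (Filter.Eventually.of_forall fun γ => by
    simp only
    rw [U.average_mem_invariants μ ψ γ⁻¹])

end UnitaryRep

section Haar

variable (G : Type*) [Group G] [TopologicalSpace G] [IsTopologicalGroup G] [CompactSpace G]
  [MeasurableSpace G] [BorelSpace G]

/-- A compact group is unimodular: right invariance makes the inverted measure left invariant, and
the Haar probability is unique. This justifies the substitution h = Ω(x) k⁻¹ in
`average_frameTensor_toLp`. -/
instance : (haarProb G).IsInvInvariant := by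
  refine ⟨?_⟩
  have h : IsProbabilityMeasure (haarProb G).inv :=
    Measure.isProbabilityMeasure_map measurable_inv.aemeasurable
  have h2 : (haarProb G).inv.IsMulLeftInvariant := inferInstance
  have h3 : (haarProb G).inv.IsHaarMeasure :=
    Measure.isHaarMeasure_of_isCompact_nonempty_interior _ Set.univ isCompact_univ (by simp)
      (by simp) (by simp)
  exact Measure.isHaarMeasure_eq_of_isProbabilityMeasure _ _

end Haar

/-! ### Stone–Weierstrass totality -/

section Compact

variable {X Y Z : Type*} [TopologicalSpace X] [CompactSpace X] [T2Space X] [MeasurableSpace X]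
  [BorelSpace X] [TopologicalSpace Y] [CompactSpace Y] [T2Space Y]
  [TopologicalSpace Z] [CompactSpace Z] [T2Space Z]

theorem exists_continuousMap_ne {x y : Y} (h : x ≠ y) : ∃ c : C(Y, ℂ), c x ≠ c y := by
  obtain ⟨f, hf0, hf1, -⟩ := exists_continuous_zero_one_of_isClosed (isClosed_singleton (x := x))
    (isClosed_singleton (x := y)) (by simpa using h)
  refine ⟨⟨fun z => (f z : ℂ), by fun_prop⟩, ?_⟩
  have h0 : f x = 0 := hf0 rfl
  have h1 : f y = 1 := hf1 rfl
  simp [h0, h1]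

/-- Products of continuous functions of two jointly injective variables are total. -/
theorem toLp_mul_total (μ : Measure X) [IsFiniteMeasure μ] [μ.WeaklyRegular] (p : C(X, Y))
    (q : C(X, Z)) (hpq : ∀ x y, p x = p y → q x = q y → x = y) (ψ : Lp ℂ 2 μ)
    (h : ∀ (c : C(Y, ℂ)) (d : C(Z, ℂ)),
      ⟪ψ, ContinuousMap.toLp 2 μ ℂ (c.comp p * d.comp q)⟫_ℂ = 0) : ψ = 0 := by
  -- The products form a submonoid closed under conjugation, so the star algebra they generate is
  -- merely their linear span, on which the hypothesis gives orthogonality to `ψ`.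
  let s : Submonoid C(X, ℂ) :=
    { carrier := {f | ∃ (c : C(Y, ℂ)) (d : C(Z, ℂ)), f = c.comp p * d.comp q}
      one_mem' := ⟨1, 1, by ext; simp⟩
      mul_mem' := by
        rintro _ _ ⟨c, d, rfl⟩ ⟨c', d', rfl⟩
        exact ⟨c * c', d * d', by ext; simp; ring⟩ }
  have hstar : star (s : Set C(X, ℂ)) = s := by
    have h1 : ∀ f ∈ s, star f ∈ s := by
      rintro _ ⟨c, d, rfl⟩
      exact ⟨star c, star d, by ext; simp⟩
    ext f
    exact ⟨fun hf => star_star f ▸ h1 _ hf, fun hf => h1 _ hf⟩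
  let S : StarSubalgebra ℂ C(X, ℂ) := StarAlgebra.adjoin ℂ (s : Set C(X, ℂ))
  have hS : S.topologicalClosure = ⊤ := by
    refine ContinuousMap.starSubalgebra_topologicalClosure_eq_top_of_separatesPoints S ?_
    intro x y hxy
    by_cases hp : p x = p y
    · have hq : q x ≠ q y := fun hq => hxy (hpq x y hp hq)
      obtain ⟨d, hd⟩ := exists_continuousMap_ne hq
      exact ⟨_, ⟨d.comp q, StarAlgebra.subset_adjoin ℂ _ ⟨1, d, by ext; simp⟩, rfl⟩, hd⟩
    · obtain ⟨c, hc⟩ := exists_continuousMap_ne hp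
      exact ⟨_, ⟨c.comp p, StarAlgebra.subset_adjoin ℂ _ ⟨c, 1, by ext; simp⟩, rfl⟩, hc⟩
  have hzero : ∀ f ∈ S, ⟪ψ, ContinuousMap.toLp 2 μ ℂ f⟫_ℂ = 0 := by
    intro f hf
    have hf' : f ∈ Submodule.span ℂ (s : Set C(X, ℂ)) := by
      have h2 : Subalgebra.toSubmodule S.toSubalgebra = Submodule.span ℂ (s : Set C(X, ℂ)) := by
        rw [StarAlgebra.adjoin_eq_span, hstar, Set.union_self, Submonoid.closure_eq]
      rw [← h2]; exact hf
    let l : C(X, ℂ) →L[ℂ] ℂ := innerSL ℂ ψ ∘L ContinuousMap.toLp 2 μ ℂ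
    have hle : Submodule.span ℂ (s : Set C(X, ℂ)) ≤ LinearMap.ker l.toLinearMap := by
      rw [Submodule.span_le]
      rintro _ ⟨c, d, rfl⟩
      exact h c d
    exact hle hf'
  have hall : ∀ f, ⟪ψ, ContinuousMap.toLp 2 μ ℂ f⟫_ℂ = 0 := by
    intro f
    have hcl : IsClosed {f : C(X, ℂ) | ⟪ψ, ContinuousMap.toLp 2 μ ℂ f⟫_ℂ = 0} :=
      isClosed_eq (by fun_prop) continuous_const
    have hf : f ∈ S.topologicalClosure := by rw [hS]; trivial
    exact closure_minimal (fun f hf => hzero f hf) hcl hf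
  have hd : DenseRange (ContinuousMap.toLp (E := ℂ) 2 μ ℂ) :=
    ContinuousMap.toLp_denseRange ℂ μ ℂ (by simp)
  have : ∀ φ : Lp ℂ 2 μ, ⟪ψ, φ⟫_ℂ = 0 := fun φ =>
    hd.induction_on φ (isClosed_eq (by fun_prop) continuous_const) hall
  exact inner_self_eq_zero.1 (this ψ)

end Compact

/-! ### Product vectors in L² of a product measure -/

section Lp

variable {X Y : Type*} [MeasurableSpace X] [MeasurableSpace Y]

theorem memLp_mul_prod {μ : Measure X} {ν : Measure Y} [SFinite μ] [SFinite ν] {f : X → ℂ}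
    {k : Y → ℂ} (hf : MemLp f 2 μ) (hk : MemLp k 2 ν) :
    MemLp (fun z : X × Y => f z.1 * k z.2) 2 (μ.prod ν) := by
  refine (memLp_two_iff_integrable_sq_norm (hf.1.comp_fst.mul hk.1.comp_snd)).2 ?_
  have h1 := (memLp_two_iff_integrable_sq_norm hf.1).1 hf
  have h2 := (memLp_two_iff_integrable_sq_norm hk.1).1 hk
  simpa [mul_pow] using h1.mul_prod h2

/-- The product vector `f ⊗ k` in `L²(μ × ν)`. -/
noncomputable def prodVec (μ : Measure X) (ν : Measure Y) [SFinite μ] [SFinite ν] (f : Lp ℂ 2 μ)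
    (k : Lp ℂ 2 ν) : Lp ℂ 2 (μ.prod ν) :=
  (memLp_mul_prod (Lp.memLp f) (Lp.memLp k)).toLp _

variable (μ : Measure X) (ν : Measure Y) [SFinite μ] [SFinite ν]

theorem coeFn_prodVec (f : Lp ℂ 2 μ) (k : Lp ℂ 2 ν) :
    prodVec μ ν f k =ᵐ[μ.prod ν] fun z => f z.1 * k z.2 := MemLp.coeFn_toLp _

theorem inner_prodVec (f f' : Lp ℂ 2 μ) (k k' : Lp ℂ 2 ν) :
    ⟪prodVec μ ν f k, prodVec μ ν f' k'⟫_ℂ = ⟪f, f'⟫_ℂ * ⟪k, k'⟫_ℂ := by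
  simp only [L2.inner_def]
  rw [← integral_prod_mul]
  refine integral_congr_ae ?_
  filter_upwards [coeFn_prodVec μ ν f k, coeFn_prodVec μ ν f' k'] with z h1 h2
  simp [h1, h2]
  ring

theorem ae_fst {P : X → Prop} (h : ∀ᵐ x ∂μ, P x) : ∀ᵐ z ∂μ.prod ν, P z.1 :=
  Measure.quasiMeasurePreserving_fst.ae h

theorem ae_snd {P : Y → Prop} (h : ∀ᵐ x ∂ν, P x) : ∀ᵐ z ∂μ.prod ν, P z.2 :=
  Measure.quasiMeasurePreserving_snd.ae h

/-- The bilinear map `(f, k) ↦ f ⊗ k` into `L²(μ × ν)`. -/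
noncomputable def prodTensor : Lp ℂ 2 μ →L[ℂ] Lp ℂ 2 ν →L[ℂ] Lp ℂ 2 (μ.prod ν) :=
  LinearMap.mkContinuous₂ (LinearMap.mk₂ ℂ (prodVec μ ν)
    (fun f f' k => by
      ext1
      filter_upwards [coeFn_prodVec μ ν (f + f') k, coeFn_prodVec μ ν f k, coeFn_prodVec μ ν f' k,
        Lp.coeFn_add (prodVec μ ν f k) (prodVec μ ν f' k), ae_fst μ ν (Lp.coeFn_add f f')]
        with z h1 h2 h3 h4 h5
      rw [h1, h4, Pi.add_apply, h2, h3, h5, Pi.add_apply, add_mul])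
    (fun c f k => by
      ext1
      filter_upwards [coeFn_prodVec μ ν (c • f) k, coeFn_prodVec μ ν f k,
        Lp.coeFn_smul c (prodVec μ ν f k), ae_fst μ ν (Lp.coeFn_smul c f)] with z h1 h2 h3 h4
      rw [h1, h3, Pi.smul_apply, h2, h4, Pi.smul_apply, smul_mul_assoc])
    (fun f k k' => by
      ext1
      filter_upwards [coeFn_prodVec μ ν f (k + k'), coeFn_prodVec μ ν f k, coeFn_prodVec μ ν f k',
        Lp.coeFn_add (prodVec μ ν f k) (prodVec μ ν f k'), ae_snd μ ν (Lp.coeFn_add k k')]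
        with z h1 h2 h3 h4 h5
      rw [h1, h4, Pi.add_apply, h2, h3, h5, Pi.add_apply, mul_add])
    (fun c f k => by
      ext1
      filter_upwards [coeFn_prodVec μ ν f (c • k), coeFn_prodVec μ ν f k,
        Lp.coeFn_smul c (prodVec μ ν f k), ae_snd μ ν (Lp.coeFn_smul c k)] with z h1 h2 h3 h4
      rw [h1, h3, Pi.smul_apply, h2, h4, Pi.smul_apply, mul_smul_comm])) 1
    (fun f k => by
      simp only [LinearMap.mk₂_apply, one_mul]
      have h := inner_prodVec μ ν f f k k
      simp only [inner_self_eq_norm_sq_to_K] at h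
      have h' : ‖prodVec μ ν f k‖ ^ 2 = (‖f‖ * ‖k‖) ^ 2 := by rw [mul_pow]; exact_mod_cast h
      exact ((pow_left_inj₀ (norm_nonneg _) (by positivity) two_ne_zero).1 h').le)

end Lp

/-! ### Continuous functions and continuous families in L² -/

section Continuous

variable {X Y : Type*} [TopologicalSpace X] [CompactSpace X] [MeasurableSpace X] [BorelSpace X]
  [TopologicalSpace Y] [CompactSpace Y] [MeasurableSpace Y] [BorelSpace Y]
  (μ : Measure X) [IsFiniteMeasure μ] (ν : Measure Y) [IsFiniteMeasure ν]

/-- Multiplication by a continuous function on `L²`. -/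
noncomputable def mulLp (c : C(X, ℂ)) : Lp ℂ 2 μ →L[ℂ] Lp ℂ 2 μ :=
  (ContinuousLinearMap.mul ℂ ℂ).holderL μ ∞ 2 2 (ContinuousMap.toLp ∞ μ ℂ c)

theorem coeFn_mulLp (c : C(X, ℂ)) (f : Lp ℂ 2 μ) : mulLp μ c f =ᵐ[μ] fun x => c x * f x := by
  filter_upwards [(ContinuousLinearMap.mul ℂ ℂ).coeFn_holder (r := 2)
    (ContinuousMap.toLp ∞ μ ℂ c) f, ContinuousMap.coeFn_toLp (p := ∞) (𝕜 := ℂ) μ c] with x h1 h2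
  rw [← h2]
  exact h1

theorem mulLp_toLp (c d : C(X, ℂ)) :
    mulLp μ c (ContinuousMap.toLp 2 μ ℂ d) = ContinuousMap.toLp 2 μ ℂ (c * d) := by
  ext1
  filter_upwards [coeFn_mulLp μ c (ContinuousMap.toLp 2 μ ℂ d),
    ContinuousMap.coeFn_toLp (p := 2) (𝕜 := ℂ) μ d,
    ContinuousMap.coeFn_toLp (p := 2) (𝕜 := ℂ) μ (c * d)] with x h1 h2 h3
  rw [h1, h2, h3]
  rfl

variable {μ ν} in
theorem compMeasurePreserving_toLp (p : C(X, Y)) (hp : MeasurePreserving p μ ν) (d : C(Y, ℂ)) :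
    Lp.compMeasurePreserving p hp (ContinuousMap.toLp 2 ν ℂ d) =
      ContinuousMap.toLp 2 μ ℂ (d.comp p) := by
  ext1
  filter_upwards [Lp.coeFn_compMeasurePreserving (ContinuousMap.toLp 2 ν ℂ d) hp,
    ContinuousMap.coeFn_toLp (p := 2) (𝕜 := ℂ) μ (d.comp p),
    hp.quasiMeasurePreserving.ae (ContinuousMap.coeFn_toLp (p := 2) (𝕜 := ℂ) ν d)] with x h1 h2 h3
  rw [h1, h2, Function.comp, h3]
  rfl

/-- Integrals of continuous families of continuous functions in `L²` are computed pointwise. -/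
theorem integral_toLp_congr {Γ : Type*} [TopologicalSpace Γ] [CompactSpace Γ] [MeasurableSpace Γ]
    [BorelSpace Γ] (ρ : Measure Γ) [IsFiniteMeasure ρ] {F F' : Γ → C(X, ℂ)} (hF : Continuous F)
    (hF' : Continuous F') (h : ∀ x, ∫ γ, F γ x ∂ρ = ∫ γ, F' γ x ∂ρ) :
    ∫ γ, ContinuousMap.toLp 2 μ ℂ (F γ) ∂ρ = ∫ γ, ContinuousMap.toLp 2 μ ℂ (F' γ) ∂ρ := by
  have hint : ∀ {F : Γ → C(X, ℂ)}, Continuous F → Integrable F ρ := fun hF =>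
    hF.integrable_of_hasCompactSupport (HasCompactSupport.of_compactSpace _)
  rw [ContinuousLinearMap.integral_comp_comm _ (hint hF),
    ContinuousLinearMap.integral_comp_comm _ (hint hF')]
  congr 1
  ext x
  rw [ContinuousMap.integral_apply (hint hF), ContinuousMap.integral_apply (hint hF'), h x]

/-- A continuous family annihilated by all continuous weights vanishes. -/
theorem eq_zero_of_integral_smul {H : Type*} [NormedAddCommGroup H] [InnerProductSpace ℂ H]
    [CompleteSpace H] [μ.IsOpenPosMeasure] {F : X → H} (hF : Continuous F)
    (h : ∀ m : C(X, ℂ), ∫ x, m x • F x ∂μ = 0) (x : X) : F x = 0 := by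
  have hint : ∀ m : C(X, ℂ), Integrable (fun x => m x • F x) μ := fun m =>
    (m.continuous.smul hF).integrable_of_hasCompactSupport (HasCompactSupport.of_compactSpace _)
  -- The weight conj(c) turns the hypothesis, paired with `F x`, into ∫ |c|² = 0. As nonempty open
  -- sets have positive measure, c vanishes everywhere, in particular c(x) = ‖F x‖².
  let c : C(X, ℂ) := ⟨fun y => ⟪F x, F y⟫_ℂ, continuous_const.inner hF⟩
  have h1 : ∫ y, ((‖c y‖ ^ 2 : ℝ) : ℂ) ∂μ = 0 := by
    have h2 := (innerSL ℂ (F x)).integral_comp_comm (hint (star c))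
    rw [h, map_zero] at h2
    rw [← h2]
    refine integral_congr_ae (Filter.Eventually.of_forall fun y => ?_)
    simp only [ContinuousMap.star_apply, map_smul, smul_eq_mul]
    change _ = star (c y) * c y
    rw [RCLike.star_def, Complex.conj_mul']
    push_cast
    rfl
  rw [integral_complex_ofReal, Complex.ofReal_eq_zero] at h1
  have hc : Continuous fun y => ‖c y‖ ^ 2 := by fun_prop
  rw [integral_eq_zero_iff_of_nonneg (fun y => by positivity)
    (hc.integrable_of_hasCompactSupport (HasCompactSupport.of_compactSpace _)),
    Continuous.ae_eq_iff_eq μ hc continuous_zero] at h1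
  have h3 := congrFun h1 x
  simp only [Pi.zero_apply, pow_eq_zero_iff two_ne_zero, norm_eq_zero] at h3
  exact inner_self_eq_zero.1 h3

/-- The operator `∫ m(x) J(x) dμ(x)` for a strongly continuous family of contractions. -/
noncomputable def weightedIntegral {H K : Type*} [NormedAddCommGroup H] [InnerProductSpace ℂ H]
    [NormedAddCommGroup K] [InnerProductSpace ℂ K] [CompleteSpace K] (m : C(X, ℂ))
    (J : X → H →ₗᵢ[ℂ] K) (hJ : ∀ ψ, Continuous fun x => J x ψ) : H →L[ℂ] K :=
  LinearMap.mkContinuous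
    { toFun := fun ψ => ∫ x, m x • J x ψ ∂μ
      map_add' := fun ψ φ => by
        have hint : ∀ ψ, Integrable (fun x => m x • J x ψ) μ := fun ψ =>
          (m.continuous.smul (hJ ψ)).integrable_of_hasCompactSupport
            (HasCompactSupport.of_compactSpace _)
        simp only [map_add, smul_add]
        exact integral_add (hint ψ) (hint φ)
      map_smul' := fun c ψ => by
        simp only [map_smul, smul_comm _ c]
        exact integral_smul c _ } (‖m‖ * μ.real Set.univ)
    (fun ψ => by
      have := norm_integral_le_of_norm_le_const (μ := μ) (C := ‖m‖ * ‖ψ‖)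
        (f := fun x => m x • J x ψ) (Filter.Eventually.of_forall fun x => by
          rw [norm_smul, LinearIsometry.norm_map]
          exact mul_le_mul_of_nonneg_right (m.norm_coe_le_norm x) (norm_nonneg _))
      calc _ ≤ _ := this
        _ = _ := by ring)

end Continuous

/-! ### Splitting the links: L²(G^F) as a tensor product -/

section Tensor

variable {G : Type*} [Group G] [TopologicalSpace G] [IsTopologicalGroup G] [CompactSpace G]
  [T2Space G] [SecondCountableTopology G] [MeasurableSpace G] [BorelSpace G]
  {E : Type*} [DecidableEq E] [Fintype E]

/-- Restriction of configurations as a continuous map. -/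
def restrictMap {F F' : Finset E} (h : F ⊆ F') : C(↥F' → G, ↥F → G) :=
  ⟨Finset.restrict₂ (π := fun _ => G) h, continuous_pi fun _ => continuous_apply _⟩

@[simp] theorem restrictMap_apply {F F' : Finset E} (h : F ⊆ F') (x : ↥F' → G) (e : ↥F) :
    restrictMap h x e = x ⟨e, h e.2⟩ := rfl

theorem measurePreserving_restrict_prod {F₁ F : Finset E} (hF : F₁ ⊆ F) :
    MeasurePreserving (fun x : ↥F → G => (restrictMap hF x, restrictMap Finset.sdiff_subset x))
      (haarPi G F) ((haarPi G F₁).prod (haarPi G ↥(F \ F₁))) := by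
  -- The difference F \ F₁ is generalised to a free set F₂, so that F itself can be replaced by F₁ ∪
  -- F₂.
  have key : ∀ F₂ : Finset E, ∀ hd : Disjoint F₁ F₂, ∀ hu : F₁ ∪ F₂ = F,
      MeasurePreserving (fun x : ↥F → G => (restrictMap hF x,
        restrictMap (hu ▸ Finset.subset_union_right : F₂ ⊆ F) x))
        (haarPi G F) ((haarPi G F₁).prod (haarPi G F₂)) := by
    rintro F₂ hd rfl
    have h := (measurePreserving_piFinsetUnion (α := fun _ : E => G) hd
      (fun _ => haarProb G)).symm
    convert h using 1
    funext x
    rw [MeasurableEquiv.eq_symm_apply]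
    funext e
    obtain ⟨e, he⟩ := e
    rcases Finset.mem_union.1 he with h1 | h1
    · exact Equiv.piFinsetUnion_left (fun _ : E => G) hd h1 he
    · exact Equiv.piFinsetUnion_right (fun _ : E => G) hd h1 he
  exact key (F \ F₁) Finset.disjoint_sdiff (Finset.union_sdiff_of_subset hF)

/-- The product map `L²(G^F₁) × L²(G^(F ∖ F₁)) → L²(G^F)`. -/
noncomputable def linkTensor {F₁ F : Finset E} (hF : F₁ ⊆ F) :
    LinkSpace G F₁ →L[ℂ] LinkSpace G (F \ F₁) →L[ℂ] LinkSpace G F :=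
  ContinuousLinearMap.compL ℂ _ _ _ (Lp.compMeasurePreservingₗᵢ ℂ _
    (measurePreserving_restrict_prod hF)).toContinuousLinearMap ∘L prodTensor _ _

theorem linkTensor_apply {F₁ F : Finset E} (hF : F₁ ⊆ F) (f : LinkSpace G F₁)
    (k : LinkSpace G (F \ F₁)) : linkTensor hF f k =
      Lp.compMeasurePreservingₗᵢ ℂ _ (measurePreserving_restrict_prod hF) (prodVec _ _ f k) := rfl

theorem isProduct_linkTensor {F₁ F : Finset E} (hF : F₁ ⊆ F) (f : LinkSpace G F₁)
    (k : LinkSpace G (F \ F₁)) : IsProduct G hF f k (linkTensor hF f k) := by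
  filter_upwards [Lp.coeFn_compMeasurePreserving (prodVec _ _ f k)
    (measurePreserving_restrict_prod (G := G) hF),
    (measurePreserving_restrict_prod (G := G) hF).quasiMeasurePreserving.ae
      (coeFn_prodVec _ _ f k)] with x h1 h2
  exact h1.trans h2

/-- A class in L² is determined almost everywhere, so the pointwise product condition is an equation
of vectors. Ampliations then become identities for a bounded bilinear map. -/
theorem isProduct_iff {F₁ F : Finset E} (hF : F₁ ⊆ F) (f : LinkSpace G F₁)
    (k : LinkSpace G (F \ F₁)) (ψ : LinkSpace G F) :
    IsProduct G hF f k ψ ↔ ψ = linkTensor hF f k := by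
  refine ⟨fun h => ?_, fun h => h ▸ isProduct_linkTensor hF f k⟩
  ext1
  filter_upwards [h, isProduct_linkTensor hF f k] with x h1 h2
  rw [h1, h2]

theorem inner_linkTensor {F₁ F : Finset E} (hF : F₁ ⊆ F) (f f' : LinkSpace G F₁)
    (k k' : LinkSpace G (F \ F₁)) :
    ⟪linkTensor hF f k, linkTensor hF f' k'⟫_ℂ = ⟪f, f'⟫_ℂ * ⟪k, k'⟫_ℂ := by
  rw [linkTensor_apply, linkTensor_apply, LinearIsometry.inner_map_map, inner_prodVec]

theorem linkTensor_toLp {F₁ F : Finset E} (hF : F₁ ⊆ F) (c : C(↥F₁ → G, ℂ))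
    (d : C(↥(F \ F₁) → G, ℂ)) :
    linkTensor hF (ContinuousMap.toLp 2 _ ℂ c) (ContinuousMap.toLp 2 _ ℂ d) =
      ContinuousMap.toLp 2 _ ℂ
        (c.comp (restrictMap hF) * d.comp (restrictMap Finset.sdiff_subset)) := by
  symm
  rw [← isProduct_iff]
  have h1 := (ExtrinsicFrame.measurePreserving_restrict₂ (G := G) hF).quasiMeasurePreserving.ae
    (ContinuousMap.coeFn_toLp (p := 2) (𝕜 := ℂ) (haarPi G F₁) c)
  have h2 := (ExtrinsicFrame.measurePreserving_restrict₂ (G := G)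
    (Finset.sdiff_subset : F \ F₁ ⊆ F)).quasiMeasurePreserving.ae
    (ContinuousMap.coeFn_toLp (p := 2) (𝕜 := ℂ) (haarPi G ↥(F \ F₁)) d)
  filter_upwards [h1, h2, ContinuousMap.coeFn_toLp (p := 2) (𝕜 := ℂ) (haarPi G F)
    (c.comp (restrictMap hF) * d.comp (restrictMap Finset.sdiff_subset))] with x h1 h2 h3
  rw [h1, h2, h3]
  rfl

theorem linkTensor_total {F₁ F : Finset E} (hF : F₁ ⊆ F) (ψ : LinkSpace G F)
    (h : ∀ f k, ⟪ψ, linkTensor hF f k⟫_ℂ = 0) : ψ = 0 := by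
  refine toLp_mul_total _ (restrictMap hF)
    (restrictMap (Finset.sdiff_subset : F \ F₁ ⊆ F)) ?_ ψ fun c d => ?_
  · intro x y h1 h2
    funext e
    by_cases he : (e : E) ∈ F₁
    · exact congrFun h1 ⟨e, he⟩
    · exact congrFun h2 ⟨e, Finset.mem_sdiff.2 ⟨e.2, he⟩⟩
  · rw [← linkTensor_toLp]
    exact h _ _

section Rep

variable {Γ : Type*} [Group Γ] [TopologicalSpace Γ] [IsTopologicalGroup Γ]

theorem linkRep_congr {ι Δ : Type*} [Fintype ι] [Group Δ] [TopologicalSpace Δ]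
    [IsTopologicalGroup Δ] {l r : ι → (Γ →ₜ* G)} {l' r' : ι → (Δ →ₜ* G)} {γ : Γ} {δ : Δ}
    (hl : ∀ i, l i γ = l' i δ) (hr : ∀ i, r i γ = r' i δ) (ψ : Lp ℂ 2 (haarPi G ι)) :
    (linkRep l r).toHom γ ψ = (linkRep l' r').toHom δ ψ := by
  have : linkAct l r γ⁻¹ = linkAct l' r' δ⁻¹ := by
    funext x i
    simp [linkAct, hl, hr]
  rw [linkRep_apply, linkRep_apply]
  simp only [this]

theorem linkRep_eq_self {ι : Type*} [Fintype ι] {l r : ι → (Γ →ₜ* G)} {γ : Γ}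
    (hl : ∀ i, l i γ = 1) (hr : ∀ i, r i γ = 1) (ψ : Lp ℂ 2 (haarPi G ι)) :
    (linkRep l r).toHom γ ψ = ψ := by
  rw [linkRep_congr (l' := l) (r' := r) (δ := 1) (by simpa using hl) (by simpa using hr), map_one]
  rfl

/-- The representation on the links of `F` induced by multipliers given for all links. -/
noncomputable def edgeRep (l r : E → (Γ →ₜ* G)) (F : Finset E) : UnitaryRep Γ (LinkSpace G F) :=
  linkRep (fun e : ↥F => l e) (fun e => r e)

theorem coeFn_linkRep {ι : Type*} [Fintype ι] (l r : ι → (Γ →ₜ* G)) (γ : Γ)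
    (ψ : Lp ℂ 2 (haarPi G ι)) :
    (linkRep l r).toHom γ ψ =ᵐ[haarPi G ι] fun x => ψ (linkAct l r γ⁻¹ x) :=
  Lp.coeFn_compMeasurePreserving ψ (measurePreserving_linkAct l r γ⁻¹)

theorem edgeRep_linkTensor (l r : E → (Γ →ₜ* G)) {F₁ F : Finset E} (hF : F₁ ⊆ F) (γ : Γ)
    (f : LinkSpace G F₁) (k : LinkSpace G (F \ F₁)) :
    (edgeRep l r F).toHom γ (linkTensor hF f k) =
      linkTensor hF ((edgeRep l r F₁).toHom γ f) ((edgeRep l r (F \ F₁)).toHom γ k) := by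
  rw [← isProduct_iff]
  have h1 := (ExtrinsicFrame.measurePreserving_restrict₂ (G := G) hF).quasiMeasurePreserving.ae
    (coeFn_linkRep (fun e : ↥F₁ => l e) (fun e => r e) γ f)
  have h2 := (ExtrinsicFrame.measurePreserving_restrict₂ (G := G)
    (Finset.sdiff_subset : F \ F₁ ⊆ F)).quasiMeasurePreserving.ae
    (coeFn_linkRep (fun e : ↥(F \ F₁) => l e) (fun e => r e) γ k)
  have h3 := (measurePreserving_linkAct (fun e : ↥F => l e) (fun e => r e)
    γ⁻¹).quasiMeasurePreserving.ae (isProduct_linkTensor hF f k)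
  filter_upwards [h1, h2, h3, coeFn_linkRep (fun e : ↥F => l e) (fun e => r e) γ
    (linkTensor hF f k)] with x h1 h2 h3 h4
  exact (h4.trans h3).trans (congrArg₂ (· * ·) h1.symm h2.symm)

end Rep

theorem measurePreserving_restrictMap {F F' : Finset E} (h : F ⊆ F') :
    MeasurePreserving (restrictMap (G := G) h) (haarPi G F') (haarPi G F) :=
  ExtrinsicFrame.measurePreserving_restrict₂ h

/-- `f ↦ 1 ⊗ f`: a state of the links `F` as a state of the links `F' ⊇ F`. -/
noncomputable def linkIncl {F F' : Finset E} (h : F ⊆ F') : LinkSpace G F →ₗᵢ[ℂ] LinkSpace G F' :=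
  Lp.compMeasurePreservingₗᵢ ℂ (restrictMap h) (measurePreserving_restrictMap h)

theorem coeFn_linkIncl {F F' : Finset E} (h : F ⊆ F') (f : LinkSpace G F) :
    linkIncl h f =ᵐ[haarPi G F'] fun x => f (restrictMap h x) :=
  Lp.coeFn_compMeasurePreserving f (measurePreserving_restrictMap h)

end Tensor

/-! ### Gauss constraints, ampliations and the electric center -/

section Phys

variable {G : Type*} [Group G] [TopologicalSpace G] [IsTopologicalGroup G] [CompactSpace G]
  [T2Space G] [SecondCountableTopology G] [MeasurableSpace G] [BorelSpace G]
  {V E : Type*} [DecidableEq V] [DecidableEq E] [Fintype V] [Fintype E]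
  {L : Lattice V E} {R : Region L}

theorem gaugeRep_linkTensor (W : Finset V) {F₁ F : Finset E} (hF : F₁ ⊆ F) (h : ↥W → G)
    (f : LinkSpace G F₁) (k : LinkSpace G (F \ F₁)) :
    (gaugeRep G L W F).toHom h (linkTensor hF f k) =
      linkTensor hF ((gaugeRep G L W F₁).toHom h f) ((gaugeRep G L W (F \ F₁)).toHom h k) :=
  edgeRep_linkTensor (fun e => siteHom G W (L.tgt e)) (fun e => siteHom G W (L.src e)) hF h f k

theorem linkTensor_mem_physSpace {F₁ F : Finset E} (hF : F₁ ⊆ F) (f : physSpace G R F₁)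
    (k : physSpace G R (F \ F₁)) : linkTensor hF (f : LinkSpace G F₁) k ∈ physSpace G R F :=
  fun h => by rw [gaugeRep_linkTensor, f.2 h, k.2 h]

/-- The product map on states satisfying the Gauss constraints off the corner. -/
noncomputable def physTensor (R : Region L) {F₁ F : Finset E} (hF : F₁ ⊆ F) :
    physSpace G R F₁ →L[ℂ] physSpace G R (F \ F₁) →L[ℂ] physSpace G R F :=
  LinearMap.mkContinuous₂
    (LinearMap.mk₂ ℂ (fun f k => ⟨linkTensor hF (f : LinkSpace G F₁) k,
        linkTensor_mem_physSpace hF f k⟩)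
      (fun f f' k => Subtype.ext ((linkTensor hF).map_add₂ (f : LinkSpace G F₁) f' k))
      (fun c f k => Subtype.ext ((linkTensor hF).map_smul₂ c (f : LinkSpace G F₁) k))
      (fun f k k' => Subtype.ext ((linkTensor hF (f : LinkSpace G F₁)).map_add k k'))
      (fun c f k => Subtype.ext ((linkTensor hF (f : LinkSpace G F₁)).map_smul c k)))
    ‖linkTensor (G := G) hF‖
    (fun f k => (linkTensor (G := G) hF).le_opNorm₂ f k)

@[simp] theorem coe_physTensor {F₁ F : Finset E} (hF : F₁ ⊆ F) (f : physSpace G R F₁)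
    (k : physSpace G R (F \ F₁)) :
    (physTensor R hF f k : LinkSpace G F) = linkTensor hF f k := rfl

theorem inner_physTensor {F₁ F : Finset E} (hF : F₁ ⊆ F) (f f' : physSpace G R F₁)
    (k k' : physSpace G R (F \ F₁)) :
    ⟪physTensor R hF f k, physTensor R hF f' k'⟫_ℂ = ⟪f, f'⟫_ℂ * ⟪k, k'⟫_ℂ := by
  simp only [Submodule.coe_inner, coe_physTensor]
  exact inner_linkTensor hF _ _ _ _

theorem isAmpliation_iff {F₁ F : Finset E} (hF : F₁ ⊆ F)
    (a : physSpace G R F₁ →L[ℂ] physSpace G R F₁) (A : physSpace G R F →L[ℂ] physSpace G R F) :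
    IsAmpliation G R hF a A ↔ ∀ f k, A (physTensor R hF f k) = physTensor R hF (a f) k := by
  constructor
  · intro h f k
    ext1
    exact (isProduct_iff _ _ _ _).1 (h f k _ (isProduct_linkTensor hF _ _))
  · intro h f k ψ hψ
    have : ψ = physTensor R hF f k := by ext1; exact (isProduct_iff _ _ _ _).1 hψ
    rw [this, h]
    exact isProduct_linkTensor hF _ _

theorem siteHom_apply (W : Finset V) (v : V) (h : ↥W → G) :
    siteHom G W v h = if hv : v ∈ W then h ⟨v, hv⟩ else 1 := by
  unfold siteHom
  split <;> rfl

variable (R) in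
/-- The part of a gauge transformation supported outside the interior of the region. -/
def exteriorPart (h : ↥R.offCorner → G) : ↥R.offCorner → G :=
  fun v => if (v : V) ∈ R.interior then 1 else h v

/-- Both endpoints of every edge of Σ are of this kind, so the exterior part does not move the links
of Σ. On all other links it agrees with h, because none of them touches an interior vertex. -/
theorem siteHom_exteriorPart_of_mem {v : V} (hv : v ∈ R.interior ∪ R.corner)
    (h : ↥R.offCorner → G) : siteHom G R.offCorner v (exteriorPart R h) = 1 := by
  by_cases hm : v ∈ R.offCorner
  · have hc : v ∉ R.corner := fun hc => Finset.disjoint_left.1 R.disjoint_corner_offCorner hc hm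
    have hi : v ∈ R.interior := (Finset.mem_union.1 hv).resolve_right hc
    simp [siteHom_apply, hm, exteriorPart, hi]
  · simp [siteHom_apply, hm]

theorem siteHom_exteriorPart_of_notMem {v : V} (hv : v ∉ R.interior) (h : ↥R.offCorner → G) :
    siteHom G R.offCorner v (exteriorPart R h) = siteHom G R.offCorner v h := by
  by_cases hm : v ∈ R.offCorner
  · simp [siteHom_apply, hm, exteriorPart, hv]
  · simp [siteHom_apply, hm]

/-- Product states are total in the states satisfying the Gauss constraints off the corner. -/
theorem physTensor_total {F : Finset E} (hF : R.edges ⊆ F) (ψ : physSpace G R F)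
    (hψ : ∀ f k, ⟪ψ, physTensor R hF f k⟫_ℂ = 0) : ψ = 0 := by
  set μ := haarPi G ↥R.offCorner
  set P₁ := (gaugeRep G L R.offCorner R.edges).average μ
  set P₂ := (gaugeRep G L R.offCorner (F \ R.edges)).average μ
  have h0 : ∀ f k, ⟪(ψ : LinkSpace G F), linkTensor hF (P₁ f) (P₂ k)⟫_ℂ = 0 := fun f k =>
    hψ ⟨P₁ f, UnitaryRep.average_mem_invariants _ μ f⟩
      ⟨P₂ k, UnitaryRep.average_mem_invariants _ μ k⟩
  -- The averages are removed one factor at a time. As P₂ k is invariant, transforming f alone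
  -- amounts to transforming the whole product, which the invariant ψ does not notice. Replacing f
  -- by P₁ f therefore leaves the inner product unchanged.
  have h1 : ∀ f k, ⟪(ψ : LinkSpace G F), linkTensor hF f (P₂ k)⟫_ℂ = 0 := by
    intro f k
    have hk : P₂ k ∈ physSpace G R (F \ R.edges) := UnitaryRep.average_mem_invariants _ μ k
    have h := UnitaryRep.map_average (gaugeRep G L R.offCorner R.edges) μ
      (innerSL ℂ (ψ : LinkSpace G F) ∘L (linkTensor hF).flip (P₂ k)) f
    have h2 : ∀ γ, ⟪(ψ : LinkSpace G F), linkTensor hF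
        ((gaugeRep G L R.offCorner R.edges).toHom γ f) (P₂ k)⟫_ℂ =
        ⟪(ψ : LinkSpace G F), linkTensor hF f (P₂ k)⟫_ℂ := by
      intro γ
      conv_lhs => rw [← hk γ]
      rw [← gaugeRep_linkTensor]
      exact UnitaryRep.inner_toHom_of_mem_invariants _ ψ.2 γ _
    simp only [ContinuousLinearMap.comp_apply, ContinuousLinearMap.flip_apply, innerSL_apply_apply,
      h2, integral_const, probReal_univ, one_smul] at h
    rw [← h]
    exact h0 f k
  -- Here f is arbitrary, so its invariance cannot be used. Instead γ is replaced by its exterior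
  -- part, which acts in the same way on k and trivially on f.
  have h3 : ∀ f k, ⟪(ψ : LinkSpace G F), linkTensor hF f k⟫_ℂ = 0 := by
    intro f k
    have h := UnitaryRep.map_average (gaugeRep G L R.offCorner (F \ R.edges)) μ
      (innerSL ℂ (ψ : LinkSpace G F) ∘L linkTensor hF f) k
    have h2 : ∀ γ, ⟪(ψ : LinkSpace G F), linkTensor hF f
        ((gaugeRep G L R.offCorner (F \ R.edges)).toHom γ k)⟫_ℂ =
        ⟪(ψ : LinkSpace G F), linkTensor hF f k⟫_ℂ := by
      intro γ
      have hf : (gaugeRep G L R.offCorner R.edges).toHom (exteriorPart R γ) f = f :=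
        linkRep_eq_self (fun e : ↥R.edges => siteHom_exteriorPart_of_mem (R.tgt_mem e e.2) γ)
          (fun e : ↥R.edges => siteHom_exteriorPart_of_mem (R.src_mem e e.2) γ) f
      have hk : (gaugeRep G L R.offCorner (F \ R.edges)).toHom γ k =
          (gaugeRep G L R.offCorner (F \ R.edges)).toHom (exteriorPart R γ) k :=
        linkRep_congr
          (fun e : ↥(F \ R.edges) => (siteHom_exteriorPart_of_notMem (fun hi =>
            (Finset.mem_sdiff.1 e.2).2 (R.mem_of_tgt e hi)) γ).symm)
          (fun e : ↥(F \ R.edges) => (siteHom_exteriorPart_of_notMem (fun hi =>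
            (Finset.mem_sdiff.1 e.2).2 (R.mem_of_src e hi)) γ).symm) k
      rw [hk]
      conv_lhs => rw [← hf]
      rw [← gaugeRep_linkTensor]
      exact UnitaryRep.inner_toHom_of_mem_invariants _ ψ.2 _ _
    simp only [ContinuousLinearMap.comp_apply, innerSL_apply_apply, h2, integral_const,
      probReal_univ, one_smul] at h
    rw [← h]
    exact h1 f k
  ext1
  exact linkTensor_total hF _ h3

theorem exists_isAmpliation {F : Finset E} (hF : R.edges ⊆ F)
    (a : physSpace G R R.edges →L[ℂ] physSpace G R R.edges) : ∃ A, IsAmpliation G R hF a A := by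
  obtain ⟨A, hA⟩ := exists_ampliation (physTensor R hF) (inner_physTensor hF)
    (physTensor_total hF) a
  exact ⟨A, (isAmpliation_iff hF a A).2 hA⟩

/-- A map that acts on the factor of the links outside `Σ` only intertwines the ampliations. -/
theorem IsAmpliation.intertwine {F F' : Finset E} {hF : R.edges ⊆ F} {hF' : R.edges ⊆ F'}
    {a : physSpace G R R.edges →L[ℂ] physSpace G R R.edges}
    {A : physSpace G R F →L[ℂ] physSpace G R F} {A' : physSpace G R F' →L[ℂ] physSpace G R F'}
    (hA : IsAmpliation G R hF a A) (hA' : IsAmpliation G R hF' a A')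
    (D : physSpace G R F →L[ℂ] physSpace G R F')
    (hD : ∀ k, ∃ k', ∀ f, D (physTensor R hF f k) = physTensor R hF' f k')
    (ψ : physSpace G R F) : A' (D ψ) = D (A ψ) := by
  have h : A' ∘L D = D ∘L A := by
    refine clm_ext_of_total (physTensor_total hF) fun f k => ?_
    obtain ⟨k', hk'⟩ := hD k
    simp only [ContinuousLinearMap.comp_apply]
    rw [hk', (isAmpliation_iff _ _ _).1 hA', (isAmpliation_iff _ _ _).1 hA, hk']
  exact DFunLike.congr_fun h ψ

theorem cornerRep_physTensor {F₁ F : Finset E} (hF : F₁ ⊆ F) (h : ↥R.corner → G)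
    (f : physSpace G R F₁) (k : physSpace G R (F \ F₁)) :
    (cornerRep G R F).toHom h (physTensor R hF f k) =
      physTensor R hF ((cornerRep G R F₁).toHom h f) ((cornerRep G R (F \ F₁)).toHom h k) := by
  ext1
  exact gaugeRep_linkTensor R.corner hF h _ _

/-- The corner group acts on a product by a product of unitaries; in the conjugation of a ⊗ 1 those
on the second factor cancel. -/
theorem IsAmpliation.twirl {F₁ F : Finset E} {hF : F₁ ⊆ F}
    {a : physSpace G R F₁ →L[ℂ] physSpace G R F₁} {A : physSpace G R F →L[ℂ] physSpace G R F}
    (hA : IsAmpliation G R hF a A) :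
    IsAmpliation G R hF ((cornerRep G R F₁).twirl (haarPi G ↥R.corner) a)
      ((cornerRep G R F).twirl (haarPi G ↥R.corner) A) := by
  rw [isAmpliation_iff] at hA ⊢
  intro f k
  have h := UnitaryRep.map_twirl (cornerRep G R F₁) (haarPi G ↥R.corner)
    ((physTensor R hF).flip k) a f
  rw [ContinuousLinearMap.flip_apply] at h
  rw [h, UnitaryRep.twirl_apply]
  refine integral_congr_ae (Filter.Eventually.of_forall fun γ => ?_)
  simp only [cornerRep_physTensor, hA, UnitaryRep.toHom_toHom_inv,
    ContinuousLinearMap.flip_apply]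

/-- `Π A Π = (twirl A) Π`. -/
theorem cornerProj_conj (A : physSpace G R (Finset.univ : Finset E) →L[ℂ]
      physSpace G R (Finset.univ : Finset E)) :
    cornerProj G R ∘L A ∘L cornerProj G R =
      (cornerRep G R Finset.univ).twirl (haarPi G ↥R.corner) A ∘L cornerProj G R := by
  ext1 ψ
  exact UnitaryRep.average_conj _ (haarPi G ↥R.corner) A ψ

/-- By `cornerProj_conj`, ΠAΠ = (twirl A)Π, and the twirl of an ampliation is an invariant
ampliation. Conversely an invariant A commutes with Π, so AΠ = ΠAΠ. -/
theorem electricCenterAlgebra_eq :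
    electricCenterAlgebra G R = (fun A => A ∘L cornerProj G R) '' invariantRegionAlgebra G R := by
  ext O
  constructor
  · rintro ⟨A, ⟨a, ha⟩, rfl⟩
    refine ⟨_, ⟨⟨_, ha.twirl⟩, fun g => ?_⟩, (cornerProj_conj A).symm⟩
    ext1 ψ
    exact UnitaryRep.toHom_twirl (cornerRep G R Finset.univ) (haarPi G ↥R.corner) A g ψ
  · rintro ⟨A, ⟨hA, hinv⟩, rfl⟩
    refine ⟨A, hA, ?_⟩
    ext1 ψ
    change cornerProj G R (A (cornerProj G R ψ)) = A (cornerProj G R ψ)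
    unfold cornerProj
    rw [UnitaryRep.average_comp_comm _ _ (fun γ φ => DFunLike.congr_fun (hinv γ) φ),
      UnitaryRep.average_of_mem_invariants _ _ (UnitaryRep.average_mem_invariants _
        (haarPi G ↥R.corner) ψ)]

end Phys

/-! ### Gauge fixing and the reduction isometry -/

section Frame

variable {G : Type*} [Group G] [TopologicalSpace G] [IsTopologicalGroup G] [CompactSpace G]
  [T2Space G] [SecondCountableTopology G] [MeasurableSpace G] [BorelSpace G]
  {V E : Type*} [DecidableEq V] [DecidableEq E] [Fintype V] [Fintype E]
  {L : Lattice V E} {R : Region L}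

/-- Gauge transformations of configurations at the vertices `W`. -/
def gaugeAct (L : Lattice V E) (W : Finset V) (F : Finset E) (h : ↥W → G) (x : ↥F → G) : ↥F → G :=
  linkAct (fun e : ↥F => siteHom G W (L.tgt e)) (fun e => siteHom G W (L.src e)) h x

theorem gaugeAct_mul (W : Finset V) (F : Finset E) (h k : ↥W → G) (x : ↥F → G) :
    gaugeAct L W F (h * k) x = gaugeAct L W F h (gaugeAct L W F k x) :=
  congrFun (linkAct_mul _ _ h k) x

theorem measurePreserving_gaugeAct (W : Finset V) (F : Finset E) (h : ↥W → G) :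
    MeasurePreserving (gaugeAct L W F h) (haarPi G F) (haarPi G F) :=
  measurePreserving_linkAct _ _ h

theorem continuous_gaugeAct (W : Finset V) (F : Finset E) :
    Continuous fun p : (↥W → G) × (↥F → G) => gaugeAct L W F p.1 p.2 :=
  continuous_linkAct _ _

theorem gaugeRep_apply (W : Finset V) (F : Finset E) (h : ↥W → G) (ψ : LinkSpace G F) :
    (gaugeRep G L W F).toHom h ψ =
      Lp.compMeasurePreserving (gaugeAct L W F h⁻¹) (measurePreserving_gaugeAct W F h⁻¹) ψ := rfl

theorem linkIncl_apply {F F' : Finset E} (h : F ⊆ F') (f : LinkSpace G F) :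
    linkIncl h f = Lp.compMeasurePreserving (restrictMap h) (measurePreserving_restrictMap h) f := rfl

/-- Transfers identities between maps of configurations to operators on L², although the proof of
measure preservation depends on the map. -/
theorem compMeasurePreserving_congr {X Y : Type*} [MeasurableSpace X] [MeasurableSpace Y]
    {μ : Measure X} {ν : Measure Y} {p q : X → Y} (h : p = q) (hp : MeasurePreserving p μ ν)
    (hq : MeasurePreserving q μ ν) (f : Lp ℂ 2 ν) :
    Lp.compMeasurePreserving p hp f = Lp.compMeasurePreserving q hq f := by subst h; rfl

theorem gaugeRep_linkIncl (W : Finset V) {F F' : Finset E} (hF : F ⊆ F') (h : ↥W → G)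
    (f : LinkSpace G F) :
    (gaugeRep G L W F').toHom h (linkIncl hF f) = linkIncl hF ((gaugeRep G L W F).toHom h f) := by
  simp only [gaugeRep_apply, linkIncl_apply]
  rw [← Lp.compMeasurePreserving_comp_apply, ← Lp.compMeasurePreserving_comp_apply]
  exact compMeasurePreserving_congr rfl _ _ f

/-- Multiplication by a gauge invariant function commutes with gauge transformations. -/
theorem gaugeRep_mulLp (W : Finset V) (F : Finset E) (h : ↥W → G) (c : C(↥F → G, ℂ))
    (hc : ∀ x, c (gaugeAct L W F h⁻¹ x) = c x) (ψ : LinkSpace G F) :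
    (gaugeRep G L W F).toHom h (mulLp _ c ψ) = mulLp _ c ((gaugeRep G L W F).toHom h ψ) := by
  ext1
  filter_upwards [coeFn_linkRep (fun e : ↥F => siteHom G W (L.tgt e))
      (fun e => siteHom G W (L.src e)) h (mulLp _ c ψ),
    coeFn_mulLp _ c ((gaugeRep G L W F).toHom h ψ),
    coeFn_linkRep (fun e : ↥F => siteHom G W (L.tgt e)) (fun e => siteHom G W (L.src e)) h ψ,
    (measurePreserving_gaugeAct (L := L) W F h⁻¹).quasiMeasurePreserving.ae (coeFn_mulLp _ c ψ)]
    with x h1 h2 h3 h4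
  refine h1.trans (h4.trans ?_)
  rw [h2, hc]
  exact congrArg _ h3.symm

namespace ExtrinsicFrame

variable (Φ : ExtrinsicFrame R)

/-- Contributions at intermediate vertices cancel, and the anchor lies on the global boundary, hence
off the corner; only the final vertex v contributes. -/
theorem orientation_gaugeAct_corner (h : ↥R.corner → G) (x : ↥(Finset.univ : Finset E) → G) :
    Φ.orientation (gaugeAct L R.corner Finset.univ h x) = h * Φ.orientation x := by
  funext v
  have h3 : L.ini ((Φ.line v).head (Φ.ne_nil v)) ∉ R.corner := fun hm =>
    Finset.disjoint_left.1 R.disjoint_corner_boundary hm (Φ.anchored v)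
  unfold gaugeAct orientation
  rw [holonomy_gauge _ _ _ _ (Φ.ne_nil v) (Φ.chain v), Φ.reaches v]
  simp [siteHom_apply, h3]

theorem orientation_gaugeAct_offCorner (h : ↥R.offCorner → G)
    (x : ↥(Finset.univ : Finset E) → G) :
    Φ.orientation (gaugeAct L R.offCorner Finset.univ h x) = Φ.orientation x := by
  funext v
  have h2 : L.fin ((Φ.line v).getLast (Φ.ne_nil v)) ∉ R.offCorner := by
    rw [Φ.reaches v]
    exact fun hm => Finset.disjoint_left.1 R.disjoint_corner_offCorner v.2 hm
  have h3 : L.ini ((Φ.line v).head (Φ.ne_nil v)) ∉ R.offCorner := fun hm => by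
    simp only [Region.offCorner, Finset.mem_sdiff] at hm
    exact hm.1.2 (Φ.anchored v)
  unfold gaugeAct orientation
  rw [holonomy_gauge _ _ _ _ (Φ.ne_nil v) (Φ.chain v)]
  simp [siteHom_apply, h2, h3]

theorem gaugeFix_eq (g : ↥R.corner → G) (x : ↥(Finset.univ : Finset E) → G) :
    Φ.gaugeFix g x = gaugeAct L R.corner Φ.systemEdges (g * (Φ.orientation x)⁻¹)
      (restrictMap (Finset.subset_univ _) x) := rfl

theorem gaugeFix_gaugeAct_corner (g h : ↥R.corner → G) (x : ↥(Finset.univ : Finset E) → G) :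
    Φ.gaugeFix g (gaugeAct L R.corner Finset.univ h x) = Φ.gaugeFix g x := by
  rw [gaugeFix_eq, orientation_gaugeAct_corner, gaugeFix_eq]
  change gaugeAct L R.corner Φ.systemEdges _ (gaugeAct L R.corner Φ.systemEdges h
    (restrictMap (Finset.subset_univ _) x)) = _
  rw [← gaugeAct_mul]
  congr 1
  group

theorem gaugeFix_change (g g' : ↥R.corner → G) (x : ↥(Finset.univ : Finset E) → G) :
    Φ.gaugeFix g' x = gaugeAct L R.corner Φ.systemEdges (g' * g⁻¹) (Φ.gaugeFix g x) := by
  rw [gaugeFix_eq, gaugeFix_eq, ← gaugeAct_mul]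
  congr 1
  group

/-- The reduction isometry on all link states. -/
noncomputable def reductionAdjKin (g : ↥R.corner → G) :
    LinkSpace G Φ.systemEdges →ₗᵢ[ℂ] LinkSpace G (Finset.univ : Finset E) :=
  Lp.compMeasurePreservingₗᵢ ℂ (Φ.gaugeFix g) (Φ.measurePreserving_gaugeFix g)

theorem reductionAdjKin_apply (g : ↥R.corner → G) (f : LinkSpace G Φ.systemEdges) :
    Φ.reductionAdjKin g f =
      Lp.compMeasurePreserving (Φ.gaugeFix g) (Φ.measurePreserving_gaugeFix g) f := rfl

theorem gaugeRep_corner_reductionAdjKin (g h : ↥R.corner → G) (f : LinkSpace G Φ.systemEdges) :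
    (gaugeRep G L R.corner Finset.univ).toHom h (Φ.reductionAdjKin g f) =
      Φ.reductionAdjKin g f := by
  rw [gaugeRep_apply, reductionAdjKin_apply, ← Lp.compMeasurePreserving_comp_apply]
  exact compMeasurePreserving_congr (funext fun x => Φ.gaugeFix_gaugeAct_corner g h⁻¹ x) _ _ f

theorem gaugeRep_offCorner_reductionAdjKin (g : ↥R.corner → G) (h : ↥R.offCorner → G)
    (f : LinkSpace G Φ.systemEdges) :
    (gaugeRep G L R.offCorner Finset.univ).toHom h (Φ.reductionAdjKin g f) =
      Φ.reductionAdjKin g ((gaugeRep G L R.offCorner Φ.systemEdges).toHom h f) := by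
  simp only [gaugeRep_apply, reductionAdjKin_apply]
  rw [← Lp.compMeasurePreserving_comp_apply, ← Lp.compMeasurePreserving_comp_apply]
  exact compMeasurePreserving_congr (funext fun x => Φ.gaugeFix_gauge g h⁻¹ x) _ _ f

/-- All orientations give isometries with the same range, differing by a corner transformation of S.
Strong continuity in the orientation is inherited from that representation. -/
theorem reductionAdjKin_change (g g' : ↥R.corner → G) (f : LinkSpace G Φ.systemEdges) :
    Φ.reductionAdjKin g' f = Φ.reductionAdjKin g
      ((gaugeRep G L R.corner Φ.systemEdges).toHom (g * g'⁻¹) f) := by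
  simp only [gaugeRep_apply, reductionAdjKin_apply]
  rw [← Lp.compMeasurePreserving_comp_apply]
  refine compMeasurePreserving_congr (funext fun x => ?_) _ _ f
  rw [Φ.gaugeFix_change g g']
  simp

theorem continuous_reductionAdjKin (f : LinkSpace G Φ.systemEdges) :
    Continuous fun g => Φ.reductionAdjKin g f := by
  rw [continuous_congr fun g => Φ.reductionAdjKin_change 1 g f]
  exact (Φ.reductionAdjKin 1).continuous.comp
    (((gaugeRep G L R.corner Φ.systemEdges).cont f).comp (by fun_prop))

/-! #### Averaging frame wave functions -/

/-- The orientation of a frame as a continuous map. -/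
def orientationMap : C(↥(Finset.univ : Finset E) → G, ↥R.corner → G) :=
  ⟨Φ.orientation, Φ.continuous_orientation⟩

/-- `f ↦ m ⊗ f`: the state in which the frame has wave function `m` and the system state `f`. -/
noncomputable def frameTensor (m : C(↥R.corner → G, ℂ)) :
    LinkSpace G Φ.systemEdges →L[ℂ] LinkSpace G (Finset.univ : Finset E) :=
  mulLp _ (m.comp Φ.orientationMap) ∘L
    (linkIncl (Finset.subset_univ Φ.systemEdges)).toContinuousLinearMap

theorem frameTensor_apply (m : C(↥R.corner → G, ℂ)) (f : LinkSpace G Φ.systemEdges) :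
    Φ.frameTensor m f = mulLp _ (m.comp Φ.orientationMap)
      (linkIncl (Finset.subset_univ Φ.systemEdges) f) := rfl

theorem frameTensor_toLp (m : C(↥R.corner → G, ℂ)) (d : C(↥Φ.systemEdges → G, ℂ)) :
    Φ.frameTensor m (ContinuousMap.toLp 2 _ ℂ d) = ContinuousMap.toLp 2 _ ℂ
      (m.comp Φ.orientationMap * d.comp (restrictMap (Finset.subset_univ Φ.systemEdges))) := by
  rw [frameTensor_apply, linkIncl_apply, compMeasurePreserving_toLp, mulLp_toLp]

/-- The formal identity Π(|k⟩ ⊗ f) = R(k)†f, smeared with m. For continuous f both sides are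
integrals of continuous functions and can be compared pointwise. -/
theorem average_frameTensor_toLp (m : C(↥R.corner → G, ℂ)) (d : C(↥Φ.systemEdges → G, ℂ)) :
    (gaugeRep G L R.corner Finset.univ).average (haarPi G ↥R.corner)
      (Φ.frameTensor m (ContinuousMap.toLp 2 _ ℂ d)) =
    ∫ k, m k • Φ.reductionAdjKin k (ContinuousMap.toLp 2 _ ℂ d) ∂haarPi G ↥R.corner := by
  set c : C(↥(Finset.univ : Finset E) → G, ℂ) :=
    m.comp Φ.orientationMap * d.comp (restrictMap (Finset.subset_univ Φ.systemEdges)) with hc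
  let act : (↥R.corner → G) → C(↥(Finset.univ : Finset E) → G, ↥(Finset.univ : Finset E) → G) :=
    fun h => ⟨gaugeAct L R.corner Finset.univ h,
      (continuous_gaugeAct _ _).comp (by fun_prop : Continuous fun x => (h, x))⟩
  let fix : (↥R.corner → G) → C(↥(Finset.univ : Finset E) → G, ↥Φ.systemEdges → G) :=
    fun k => ⟨Φ.gaugeFix k, Φ.continuous_gaugeFix k⟩
  have hact : Continuous act :=
    ContinuousMap.continuous_of_continuous_uncurry act (continuous_gaugeAct _ _)
  have hfix : Continuous fix := by
    refine ContinuousMap.continuous_of_continuous_uncurry fix ?_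
    change Continuous fun p : (↥R.corner → G) × (↥(Finset.univ : Finset E) → G) =>
      gaugeAct L R.corner Φ.systemEdges (p.1 * (Φ.orientation p.2)⁻¹)
        (restrictMap (Finset.subset_univ _) p.2)
    have ho := (Φ.continuous_orientation (G := G)).comp
      (continuous_snd (X := ↥R.corner → G))
    exact (continuous_gaugeAct _ _).comp ((continuous_fst.mul ho.inv).prodMk
      ((restrictMap _).continuous.comp continuous_snd))
  rw [frameTensor_toLp, ← hc, UnitaryRep.average_apply]
  have h1 : ∀ h, (gaugeRep G L R.corner Finset.univ).toHom h (ContinuousMap.toLp 2 _ ℂ c) =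
      ContinuousMap.toLp 2 _ ℂ (c.comp (act h⁻¹)) := fun h =>
    compMeasurePreserving_toLp (act h⁻¹) (measurePreserving_gaugeAct _ _ h⁻¹) c
  have h2 : ∀ k, m k • Φ.reductionAdjKin k (ContinuousMap.toLp 2 _ ℂ d) =
      ContinuousMap.toLp 2 _ ℂ (m k • d.comp (fix k)) := fun k => by
    rw [map_smul]
    exact congrArg (m k • ·)
      (compMeasurePreserving_toLp (fix k) (Φ.measurePreserving_gaugeFix k) d)
  simp only [h1, h2]
  refine integral_toLp_congr _ _
    ((ContinuousMap.continuous_postcomp c).comp (hact.comp continuous_inv))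
    (m.continuous.smul ((ContinuousMap.continuous_postcomp d).comp hfix)) fun x => ?_
  let w : (↥R.corner → G) → ℂ := fun h => c (act h⁻¹ x)
  change ∫ h, w h ∂haarPi G ↥R.corner = _
  -- With Ω(x) the orientation of x, substitute h = Ω(x) k⁻¹: the transform of x by h⁻¹ then has
  -- orientation k, and its system part is `gaugeFix k x`.
  rw [← integral_div_left_eq_self w _ (Φ.orientation x)]
  refine integral_congr_ae (Filter.Eventually.of_forall fun k => ?_)
  have h3 : Φ.orientation (gaugeAct L R.corner Finset.univ (Φ.orientation x / k)⁻¹ x) = k := by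
    rw [orientation_gaugeAct_corner, inv_div, div_mul_cancel]
  change m (Φ.orientation (gaugeAct L R.corner Finset.univ (Φ.orientation x / k)⁻¹ x)) *
    d (gaugeAct L R.corner Φ.systemEdges (Φ.orientation x / k)⁻¹
      (restrictMap (Finset.subset_univ _) x)) = m k * d (Φ.gaugeFix k x)
  rw [h3, gaugeFix_eq, inv_div, div_eq_mul_inv]

theorem average_frameTensor (m : C(↥R.corner → G, ℂ)) (f : LinkSpace G Φ.systemEdges) :
    (gaugeRep G L R.corner Finset.univ).average (haarPi G ↥R.corner) (Φ.frameTensor m f) =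
    ∫ k, m k • Φ.reductionAdjKin k f ∂haarPi G ↥R.corner := by
  have hd : DenseRange (ContinuousMap.toLp (E := ℂ) 2 (haarPi G ↥Φ.systemEdges) ℂ) :=
    ContinuousMap.toLp_denseRange ℂ _ ℂ (by simp)
  have h := hd.equalizer
    ((gaugeRep G L R.corner Finset.univ).average (haarPi G ↥R.corner) ∘L
      Φ.frameTensor m).continuous
    (weightedIntegral (haarPi G ↥R.corner) m Φ.reductionAdjKin
      Φ.continuous_reductionAdjKin).continuous
    (funext fun d => Φ.average_frameTensor_toLp m d)
  exact congrFun h f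

/-- States invariant under the corner gauge group lie in the range of the reduction isometry. -/
theorem exists_reductionAdjKin_eq (g : ↥R.corner → G) (ψ : LinkSpace G (Finset.univ : Finset E))
    (hψ : ψ ∈ (gaugeRep G L R.corner Finset.univ).invariants) :
    ∃ f, Φ.reductionAdjKin g f = ψ := by
  set U := gaugeRep G L R.corner (Finset.univ : Finset E)
  set J := (Φ.reductionAdjKin g).toContinuousLinearMap
  refine ⟨ContinuousLinearMap.adjoint J ψ, ?_⟩
  -- `q` is the component of ψ orthogonal to the range of the isometry. It is still corner
  -- invariant.
  set q := ψ - J (ContinuousLinearMap.adjoint J ψ) with hq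
  have hqU : q ∈ U.invariants :=
    sub_mem hψ fun h => Φ.gaugeRep_corner_reductionAdjKin g h _
  have hqJ : ∀ f, ⟪q, Φ.reductionAdjKin g f⟫_ℂ = 0 := by
    intro f
    change ⟪q, J f⟫_ℂ = 0
    rw [hq, inner_sub_left, ← ContinuousLinearMap.adjoint_inner_left, sub_eq_zero]
    exact ((Φ.reductionAdjKin g).inner_map_map _ _).symm
  have hq0 : q = 0 := by
    -- Orientation and system links determine the configuration: each path has exactly one link
    -- outside S, its last one, which is solved for from the holonomy.
    refine toLp_mul_total _ Φ.orientationMap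
      (restrictMap (Finset.subset_univ Φ.systemEdges)) ?_ q fun m d => ?_
    · intro x y h1 h2
      have hS : ∀ e : ↥(Finset.univ : Finset E), (e : E) ∉ Φ.lastEdges → x e = y e :=
        fun e he => congrFun h2 ⟨e, Finset.mem_sdiff.2 ⟨e.2, he⟩⟩
      funext e
      by_cases he : (e : E) ∈ Φ.lastEdges
      · obtain ⟨v, -, hv⟩ := Finset.mem_image.1 he
        have h3 : holonomy x (Φ.line v) = holonomy y (Φ.line v) := congrFun h1 v
        have hdec : (Φ.line v).dropLast ++ [Φ.lastStep v] = Φ.line v :=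
          List.dropLast_append_getLast (Φ.ne_nil v)
        rw [← hdec, holonomy_append, holonomy_append,
          holonomy_congr fun s hs => hS _ (Φ.fst_notMem_lastEdges hs), mul_right_cancel_iff] at h3
        simp only [holonomy, one_mul] at h3
        have hv' : e = ⟨(Φ.lastStep v).1, Finset.mem_univ _⟩ := Subtype.ext hv.symm
        rw [hv']
        unfold stepVal at h3
        split at h3
        · exact h3
        · exact inv_injective h3
      · exact hS e he
    -- Invariance of `q` allows the average to be inserted before m ⊗ d. This gives an integral of
    -- vectors R(k)†d, all in the range of R(g)† and hence orthogonal to `q`.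
    · rw [← frameTensor_toLp, ← UnitaryRep.inner_average_of_mem_invariants U
        (haarPi G ↥R.corner) hqU, average_frameTensor, ← innerSL_apply_apply,
        ← ContinuousLinearMap.integral_comp_comm]
      · have h4 : ∀ k, ⟪q, m k • Φ.reductionAdjKin k (ContinuousMap.toLp 2 _ ℂ d)⟫_ℂ = 0 :=
          fun k => by rw [inner_smul_right, Φ.reductionAdjKin_change g, hqJ, mul_zero]
        simp only [innerSL_apply_apply, h4, integral_zero]
      · exact UnitaryRep.integrable_of_continuous _
          (m.continuous.smul (Φ.continuous_reductionAdjKin _))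
  exact (sub_eq_zero.1 hq0).symm

end ExtrinsicFrame

end Frame

/-! ### Reorientations and relational algebras -/

section Frame

variable {G : Type*} [Group G] [TopologicalSpace G] [IsTopologicalGroup G] [CompactSpace G]
  [T2Space G] [SecondCountableTopology G] [MeasurableSpace G] [BorelSpace G]
  {V E : Type*} [DecidableEq V] [DecidableEq E] [Fintype V] [Fintype E]
  {L : Lattice V E} {R : Region L}

namespace ExtrinsicFrame

variable (Φ Φ' : ExtrinsicFrame R)

theorem firstStep_mem (v : ↥R.corner) : Φ.firstStep v ∈ Φ.line v := List.head_mem _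

theorem firstStep_fst_injective {v w : ↥R.corner} (h : (Φ.firstStep v).1 = (Φ.firstStep w).1) :
    v = w := by
  by_contra hne
  exact Φ.edge_disjoint v w hne _ (Φ.firstStep_mem v) _ (Φ.firstStep_mem w) h

/-- The first edge of a Wilson line is not used by any other step of the lines of the frame. -/
theorem fst_ne_firstStep {v w : ↥R.corner} {s : Lattice.Step E} (hs : s ∈ (Φ.line v).tail) :
    s.1 ≠ (Φ.firstStep w).1 := by
  intro hsw
  have hsl : s ∈ Φ.line v := List.mem_of_mem_tail hs
  have hwv : w = v := by
    by_contra hne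
    exact Φ.edge_disjoint w v hne _ (Φ.firstStep_mem w) _ hsl hsw.symm
  subst hwv
  have hdec : Φ.firstStep w :: (Φ.line w).tail = Φ.line w := List.cons_head_tail (Φ.ne_nil w)
  have hnodup := Φ.simple w
  rw [← hdec, List.map_cons, List.nodup_cons] at hnodup
  by_cases hdir : s.2 = (Φ.firstStep w).2
  · have hsf : s = Φ.firstStep w := Prod.ext hsw hdir
    exact hnodup.1 (List.mem_map.2 ⟨s, hs, by rw [hsf]⟩)
  -- Traversed backwards, the first edge would lead back to the anchor, but no step ends on the
  -- global boundary.
  · have hfin : L.fin s = L.ini (Φ.firstStep w) := by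
      rcases h1 : s with ⟨e, b⟩
      rcases h2 : Φ.firstStep w with ⟨e', b'⟩
      rw [h1, h2] at hdir hsw
      cases b <;> cases b' <;> simp_all [Lattice.ini, Lattice.fin]
    exact Φ.off_boundary w s hsl (hfin ▸ Φ.anchored w)

theorem markHom_eq_one {m : ↥R.corner → Lattice.Step E} {s : Lattice.Step E}
    (hs : ∀ v, m v ≠ s) (h : ↥R.corner → G) : markHom G m s h = 1 := by
  have : ¬ ∃ v, m v = s := fun ⟨v, hv⟩ => hs v hv
  simp [markHom, this]

/-- Reorientations of the frame acting on configurations. -/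
noncomputable def reorientAct (F : Finset E) (h : ↥R.corner → G) (x : ↥F → G) : ↥F → G :=
  linkAct (fun e : ↥F => markHom G Φ.firstStep ((e : E), false))
    (fun e => markHom G Φ.firstStep ((e : E), true)) h x

theorem measurePreserving_reorientAct (F : Finset E) (h : ↥R.corner → G) :
    MeasurePreserving (Φ.reorientAct F h) (haarPi G F) (haarPi G F) :=
  measurePreserving_linkAct _ _ h

theorem reorientAct_of_forall_ne (F : Finset E) (h : ↥R.corner → G) (x : ↥F → G) (e : ↥F)
    (he : ∀ v, (e : E) ≠ (Φ.firstStep v).1) : Φ.reorientAct F h x e = x e := by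
  have : ∀ b, markHom G Φ.firstStep ((e : E), b) h = 1 := fun b =>
    markHom_eq_one (fun v hv => he v (by rw [hv])) h
  simp [reorientAct, linkAct, this]

/-- The first edge enters each path once, as the rightmost factor of the holonomy. Reorientations
thus act on the side opposite to the corner gauge group. -/
theorem orientation_reorientAct (h : ↥R.corner → G) (x : ↥(Finset.univ : Finset E) → G) :
    Φ.orientation (Φ.reorientAct Finset.univ h x) = Φ.orientation x * h⁻¹ := by
  funext v
  have hdec : Φ.firstStep v :: (Φ.line v).tail = Φ.line v := List.cons_head_tail (Φ.ne_nil v)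
  have hinj : Function.Injective Φ.firstStep := fun v w hvw =>
    Φ.firstStep_fst_injective (congrArg Prod.fst hvw)
  have hfirst : stepVal (Φ.reorientAct Finset.univ h x) (Φ.firstStep v) =
      stepVal x (Φ.firstStep v) * (h v)⁻¹ := by
    have h1 := markHom_of_eq (G := G) hinj v h
    have h2 : ∀ b, b ≠ (Φ.firstStep v).2 →
        markHom G Φ.firstStep ((Φ.firstStep v).1, b) h = 1 := by
      refine fun b hb => markHom_eq_one (fun w hw => hb ?_) h
      have hwv : w = v := Φ.firstStep_fst_injective (by rw [hw])
      rw [← hwv, hw]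
    rcases hs : Φ.firstStep v with ⟨e, b⟩
    rw [hs] at h1 h2
    cases b
    · have h3 := h2 true (by simp)
      simp only at h3
      simp [stepVal, reorientAct, linkAct, h1, h3]
    · have h3 := h2 false (by simp)
      simp only at h3
      simp [stepVal, reorientAct, linkAct, h1, h3]
  have htail : holonomy (Φ.reorientAct Finset.univ h x) (Φ.line v).tail =
      holonomy x (Φ.line v).tail :=
    holonomy_congr fun s hs =>
      Φ.reorientAct_of_forall_ne _ h x _ fun w => Φ.fst_ne_firstStep hs
  simp only [orientation, Pi.mul_apply, Pi.inv_apply]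
  rw [← hdec]
  simp only [holonomy]
  rw [htail, hfirst, mul_assoc]

variable {Φ Φ'} in
theorem NonOverlapping.orientation_reorientAct (hn : Φ.NonOverlapping Φ') (h : ↥R.corner → G)
    (x : ↥(Finset.univ : Finset E) → G) :
    Φ.orientation (Φ'.reorientAct Finset.univ h x) = Φ.orientation x :=
  funext fun v => holonomy_congr fun s hs =>
    Φ'.reorientAct_of_forall_ne _ h x _ fun w => hn v w s hs _ (Φ'.firstStep_mem w)

theorem markHom_commute_corner (s : Lattice.Step E) (h k : ↥R.corner → G) :
    Commute (markHom G Φ.firstStep s h) (siteHom G R.corner (L.ini s) k) := by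
  by_cases hs : ∃ v, Φ.firstStep v = s
  · obtain ⟨v, rfl⟩ := hs
    have : L.ini (Φ.firstStep v) ∉ R.corner := fun hm =>
      Finset.disjoint_left.1 R.disjoint_corner_boundary hm (Φ.anchored v)
    simp [siteHom_apply, this]
  · rw [markHom_eq_one (fun v hv => hs ⟨v, hv⟩)]
    exact Commute.one_left _

/-- A reorientation multiplies a link at its anchor end, where the corner group acts trivially. This
covers a path consisting of a single edge, whose other end is a corner vertex. -/
theorem gaugeAct_reorientAct (F : Finset E) (k h : ↥R.corner → G) (x : ↥F → G) :
    gaugeAct L R.corner F k (Φ.reorientAct F h x) = Φ.reorientAct F h (gaugeAct L R.corner F k x) := by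
  funext e
  have h1 : Commute (markHom G Φ.firstStep ((e : E), false) h) (siteHom G R.corner (L.tgt e) k) :=
    Φ.markHom_commute_corner ((e : E), false) h k
  have h2 : Commute (markHom G Φ.firstStep ((e : E), true) h) (siteHom G R.corner (L.src e) k) :=
    Φ.markHom_commute_corner ((e : E), true) h k
  simp only [gaugeAct, reorientAct, linkAct]
  rw [← mul_assoc, ← mul_assoc, ← h1.eq, mul_assoc _ _ (siteHom G R.corner (L.src e) k)⁻¹,
    h2.inv_inv.eq]
  simp only [mul_assoc]

/-- The heart of the argument: g(Ωh⁻¹)⁻¹ = (g h g⁻¹)(gΩ⁻¹), so a right multiplication of the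
orientation Ω reappears as a corner transformation of S. The remaining reorientation acts on those
first edges that belong to S. -/
theorem gaugeFix_reorientAct (g h : ↥R.corner → G) (x : ↥(Finset.univ : Finset E) → G) :
    Φ.gaugeFix g (Φ.reorientAct Finset.univ h x) = Φ.reorientAct Φ.systemEdges h
      (gaugeAct L R.corner Φ.systemEdges (g * h * g⁻¹) (Φ.gaugeFix g x)) := by
  rw [gaugeFix_eq, orientation_reorientAct, gaugeFix_eq, ← gaugeAct_mul, ← gaugeAct_reorientAct]
  change gaugeAct L R.corner Φ.systemEdges _ (Φ.reorientAct Φ.systemEdges h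
    (restrictMap (Finset.subset_univ _) x)) = _
  congr 1
  group

variable {Φ Φ'} in
-- Since the orientation of Φ does not change, no corner transformation appears, in contrast to the
-- case of a single frame.
theorem NonOverlapping.gaugeFix_reorientAct (hn : Φ.NonOverlapping Φ') (g h : ↥R.corner → G)
    (x : ↥(Finset.univ : Finset E) → G) :
    Φ.gaugeFix g (Φ'.reorientAct Finset.univ h x) =
      Φ'.reorientAct Φ.systemEdges h (Φ.gaugeFix g x) := by
  rw [gaugeFix_eq, hn.orientation_reorientAct, gaugeFix_eq, ← gaugeAct_reorientAct]
  rfl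

/-! #### Reorientations of the states of a set of links -/

/-- Reorientations acting on the states of the links `F`. -/
noncomputable def reorientOn (F : Finset E) : UnitaryRep (↥R.corner → G) (LinkSpace G F) :=
  edgeRep (fun e => markHom G Φ.firstStep (e, false)) (fun e => markHom G Φ.firstStep (e, true)) F

theorem reorientOn_apply (F : Finset E) (h : ↥R.corner → G) (ψ : LinkSpace G F) :
    (Φ.reorientOn F).toHom h ψ = Lp.compMeasurePreserving (Φ.reorientAct F h⁻¹)
      (Φ.measurePreserving_reorientAct F h⁻¹) ψ := rfl

theorem reorientOn_mem_physSpace (F : Finset E) (h : ↥R.corner → G) (ψ : LinkSpace G F)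
    (hψ : ψ ∈ physSpace G R F) : (Φ.reorientOn F).toHom h ψ ∈ physSpace G R F := fun δ => by
  have hc := linkRep_commute (fun e : ↥F => markHom G Φ.firstStep ((e : E), false))
    (fun e => markHom G Φ.firstStep ((e : E), true))
    (fun e => siteHom G R.offCorner (L.tgt e)) (fun e => siteHom G R.offCorner (L.src e))
    (fun e γ δ => Φ.markHom_commute (e, false) γ δ)
    (fun e γ δ => Φ.markHom_commute (e, true) γ δ) h δ ψ
  change (Φ.reorientOn F).toHom h ((gaugeRep G L R.offCorner F).toHom δ ψ) = _ at hc
  rw [hψ δ] at hc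
  exact hc.symm

/-- Reorientations acting on the states of the links `F` that satisfy the Gauss constraints. -/
noncomputable def reorientPhys (F : Finset E) : UnitaryRep (↥R.corner → G) (physSpace G R F) :=
  (Φ.reorientOn F).restrict _ (Φ.reorientOn_mem_physSpace F)

theorem reorientPhys_physTensor {F : Finset E} (hF : R.edges ⊆ F) (h : ↥R.corner → G)
    (f : physSpace G R R.edges) (k : physSpace G R (F \ R.edges)) :
    (Φ.reorientPhys F).toHom h (physTensor R hF f k) =
      physTensor R hF f ((Φ.reorientPhys (F \ R.edges)).toHom h k) := by
  have hone : ∀ (e : ↥R.edges) b, markHom G Φ.firstStep ((e : E), b) h = 1 := fun e b =>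
    markHom_eq_one (fun v hv => Φ.extrinsic v _ (Φ.firstStep_mem v) (by rw [hv]; exact e.2)) h
  have hf : (Φ.reorientOn R.edges).toHom h (f : LinkSpace G R.edges) = f :=
    linkRep_eq_self (fun e => hone e false) (fun e => hone e true) _
  ext1
  change (Φ.reorientOn F).toHom h (linkTensor hF (f : LinkSpace G R.edges) k) =
    linkTensor hF (f : LinkSpace G R.edges) ((Φ.reorientOn (F \ R.edges)).toHom h k)
  conv_rhs => rw [← hf]
  exact edgeRep_linkTensor _ _ hF h _ _

theorem isAmpliation_reorientPhys {F : Finset E} {hF : R.edges ⊆ F}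
    {a : physSpace G R R.edges →L[ℂ] physSpace G R R.edges}
    {A : physSpace G R F →L[ℂ] physSpace G R F} (hA : IsAmpliation G R hF a A)
    (h : ↥R.corner → G) (ψ : physSpace G R F) :
    A ((Φ.reorientPhys F).toHom h ψ) = (Φ.reorientPhys F).toHom h (A ψ) :=
  hA.intertwine hA ((Φ.reorientPhys F).op h)
    (fun k => ⟨_, fun f => Φ.reorientPhys_physTensor hF h f k⟩) ψ

theorem reorientPhys_reductionAdj (g h : ↥R.corner → G) (f : physSpace G R Φ.systemEdges) :
    (Φ.reorientPhys Finset.univ).toHom h (Φ.reductionAdj G g f) =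
      Φ.reductionAdj G g ((cornerRep G R Φ.systemEdges).toHom (g * h * g⁻¹)
        ((Φ.reorientPhys Φ.systemEdges).toHom h f)) := by
  ext1
  change (Φ.reorientOn Finset.univ).toHom h (Φ.reductionAdjKin g f) =
    Φ.reductionAdjKin g ((gaugeRep G L R.corner Φ.systemEdges).toHom (g * h * g⁻¹)
      ((Φ.reorientOn Φ.systemEdges).toHom h f))
  simp only [gaugeRep_apply, reorientOn_apply, reductionAdjKin_apply]
  rw [← Lp.compMeasurePreserving_comp_apply, ← Lp.compMeasurePreserving_comp_apply,
    ← Lp.compMeasurePreserving_comp_apply]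
  refine compMeasurePreserving_congr (funext fun x => ?_) _ _ _
  have h1 : (g * h * g⁻¹)⁻¹ = g * h⁻¹ * g⁻¹ := by group
  simp only [Function.comp, h1]
  exact Φ.gaugeFix_reorientAct g h⁻¹ x

variable {Φ Φ'} in
theorem NonOverlapping.reorientPhys_reductionAdj (hn : Φ.NonOverlapping Φ') (g h : ↥R.corner → G)
    (f : physSpace G R Φ.systemEdges) :
    (Φ'.reorientPhys Finset.univ).toHom h (Φ.reductionAdj G g f) =
      Φ.reductionAdj G g ((Φ'.reorientPhys Φ.systemEdges).toHom h f) := by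
  ext1
  change (Φ'.reorientOn Finset.univ).toHom h (Φ.reductionAdjKin g f) =
    Φ.reductionAdjKin g ((Φ'.reorientOn Φ.systemEdges).toHom h f)
  simp only [reorientOn_apply, reductionAdjKin_apply]
  rw [← Lp.compMeasurePreserving_comp_apply, ← Lp.compMeasurePreserving_comp_apply]
  exact compMeasurePreserving_congr (funext fun x => hn.gaugeFix_reorientAct g h⁻¹ x) _ _ _

/-! #### The reduction isometry and the corner projection -/

theorem reductionAdj_mem_invariants (g : ↥R.corner → G) (f : physSpace G R Φ.systemEdges) :
    Φ.reductionAdj G g f ∈ (cornerRep G R Finset.univ).invariants := fun h =>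
  Subtype.ext (Φ.gaugeRep_corner_reductionAdjKin g h f)

theorem exists_reductionAdj_eq (g : ↥R.corner → G)
    (ψ : physSpace G R (Finset.univ : Finset E))
    (hψ : ψ ∈ (cornerRep G R Finset.univ).invariants) : ∃ f, Φ.reductionAdj G g f = ψ := by
  obtain ⟨f, hf⟩ := Φ.exists_reductionAdjKin_eq g (ψ : LinkSpace G (Finset.univ : Finset E))
    (fun h => congrArg Subtype.val (hψ h))
  have hfp : f ∈ physSpace G R Φ.systemEdges := fun h => by
    -- The isometry commutes with gauge transformations off the corner, so the Gauss constraints of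
    -- ψ pass to f.
    apply (Φ.reductionAdjKin g).injective
    rw [← gaugeRep_offCorner_reductionAdjKin, hf]
    exact ψ.2 h
  exact ⟨⟨f, hfp⟩, Subtype.ext hf⟩

theorem inner_reduction_right (g : ↥R.corner → G) (f : physSpace G R Φ.systemEdges)
    (ψ : physSpace G R (Finset.univ : Finset E)) :
    ⟪f, Φ.reduction G g ψ⟫_ℂ = ⟪Φ.reductionAdj G g f, ψ⟫_ℂ :=
  ContinuousLinearMap.adjoint_inner_right (Φ.reductionAdj G g).toContinuousLinearMap f ψ

/-- `R_Φ(g)† R_Φ(g) = Π`. -/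
theorem reductionAdj_reduction (g : ↥R.corner → G)
    (ψ : physSpace G R (Finset.univ : Finset E)) :
    Φ.reductionAdj G g (Φ.reduction G g ψ) = cornerProj G R ψ := by
  obtain ⟨f, hf⟩ := Φ.exists_reductionAdj_eq g (cornerProj G R ψ)
    (UnitaryRep.average_mem_invariants _ (haarPi G ↥R.corner) ψ)
  rw [← hf]
  congr 1
  -- It remains to identify R(g)ψ with f, where R(g)†f = Πψ. Tested against R(g)†f', which is corner
  -- invariant, Π can be dropped.
  refine ext_inner_left ℂ fun f' => ?_
  rw [inner_reduction_right, ← (Φ.reductionAdj G g).inner_map_map f' f, hf]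
  exact (UnitaryRep.inner_average_of_mem_invariants _ (haarPi G ↥R.corner)
    (Φ.reductionAdj_mem_invariants g f') ψ).symm

theorem continuous_reductionAdj (f : physSpace G R Φ.systemEdges) :
    Continuous fun g => Φ.reductionAdj G g f :=
  (Φ.continuous_reductionAdjKin (f : LinkSpace G Φ.systemEdges)).subtype_mk _

theorem frameTensor_mem_physSpace (m : C(↥R.corner → G, ℂ)) (f : physSpace G R Φ.systemEdges) :
    Φ.frameTensor m (f : LinkSpace G Φ.systemEdges) ∈ physSpace G R Finset.univ := fun h => by
  rw [frameTensor_apply, gaugeRep_mulLp, gaugeRep_linkIncl, f.2 h]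
  intro x
  exact congrArg m (Φ.orientation_gaugeAct_offCorner h⁻¹ x)

/-- `f ↦ m ⊗ f` on states satisfying the Gauss constraints off the corner. -/
noncomputable def frameTensorPhys (m : C(↥R.corner → G, ℂ)) :
    physSpace G R Φ.systemEdges →L[ℂ] physSpace G R (Finset.univ : Finset E) :=
  (Φ.frameTensor m ∘L (physSpace G R Φ.systemEdges).subtypeL).codRestrict _
    (Φ.frameTensor_mem_physSpace m)

theorem average_frameTensorPhys (m : C(↥R.corner → G, ℂ)) (f : physSpace G R Φ.systemEdges) :
    cornerProj G R (Φ.frameTensorPhys m f) =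
      ∫ k, m k • Φ.reductionAdj G k f ∂haarPi G ↥R.corner := by
  have hL := UnitaryRep.map_average (cornerRep G R Finset.univ) (haarPi G ↥R.corner)
    (physSpace G R (Finset.univ : Finset E)).subtypeL (Φ.frameTensorPhys m f)
  have hR := (physSpace G R (Finset.univ : Finset E)).subtypeL.integral_comp_comm
    (UnitaryRep.integrable_of_continuous (haarPi G ↥R.corner)
      (m.continuous.smul (Φ.continuous_reductionAdj f)))
  refine Subtype.ext (hL.trans (Eq.trans ?_ hR))
  exact Φ.average_frameTensor m (f : LinkSpace G Φ.systemEdges)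

/-- Extension of a configuration by the unit on the links of the region. -/
def extendOne (F : Finset E) : C(↥F → G, ↥(Finset.univ : Finset E) → G) :=
  ⟨fun x e => if he : (e : E) ∈ F then x ⟨e, he⟩ else 1, continuous_pi fun e => by
    by_cases he : (e : E) ∈ F
    · simpa [he] using continuous_apply _
    · simpa [he] using continuous_const⟩

theorem restrictMap_extendOne (F : Finset E) (x : ↥F → G) :
    restrictMap (Finset.subset_univ F) (extendOne F x) = x := by
  funext e
  simp [extendOne]

/-- The paths avoid Σ, so the values filled in on its links are irrelevant and a frame wave function
is a function of the exterior links alone. -/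
theorem orientation_extendOne (x : ↥(Finset.univ : Finset E) → G) :
    Φ.orientation (extendOne (Finset.univ \ R.edges) (restrictMap Finset.sdiff_subset x)) =
      Φ.orientation x :=
  funext fun v => holonomy_congr fun s hs => by simp [extendOne, Φ.extrinsic v s hs]

/-- Multiplication by a frame wave function, as an operator on the links outside the region. -/
theorem exists_frameTensorPhys_physTensor (m : C(↥R.corner → G, ℂ))
    (k : physSpace G R (Φ.systemEdges \ R.edges)) :
    ∃ k', ∀ f, Φ.frameTensorPhys m (physTensor R Φ.edges_subset_systemEdges f k) =
      physTensor R (Finset.subset_univ R.edges) f k' := by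
  have hsub : Φ.systemEdges \ R.edges ⊆ Finset.univ \ R.edges :=
    Finset.sdiff_subset_sdiff (Finset.subset_univ _) subset_rfl
  let c : C(↥(Finset.univ \ R.edges) → G, ℂ) := (m.comp Φ.orientationMap).comp (extendOne _)
  have hc : ∀ x : ↥(Finset.univ : Finset E) → G,
      c (restrictMap Finset.sdiff_subset x) = m (Φ.orientation x) := fun x =>
    congrArg m (Φ.orientation_extendOne x)
  have hmem : mulLp _ c (linkIncl hsub (k : LinkSpace G (Φ.systemEdges \ R.edges))) ∈
      physSpace G R (Finset.univ \ R.edges) := fun h => by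
    rw [gaugeRep_mulLp, gaugeRep_linkIncl, k.2 h]
    intro y
    -- Gauge invariance of `c` is read off from that of the orientation, after extending the
    -- exterior configuration to all links.
    have hy : y = restrictMap Finset.sdiff_subset (extendOne _ y) :=
      (restrictMap_extendOne _ y).symm
    have h2 : gaugeAct L R.offCorner (Finset.univ \ R.edges) h⁻¹ y =
        restrictMap Finset.sdiff_subset
          (gaugeAct L R.offCorner Finset.univ h⁻¹ (extendOne _ y)) := by
      conv_lhs => rw [hy]
      rfl
    conv_rhs => rw [hy]
    rw [h2, hc, hc, orientation_gaugeAct_offCorner]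
  refine ⟨⟨_, hmem⟩, fun f => ?_⟩
  ext1
  rw [coe_physTensor, ← isProduct_iff]
  set T := linkTensor Φ.edges_subset_systemEdges (f : LinkSpace G R.edges)
    (k : LinkSpace G (Φ.systemEdges \ R.edges))
  have e1 := coeFn_mulLp _ (m.comp Φ.orientationMap)
    (linkIncl (Finset.subset_univ Φ.systemEdges) T)
  have e2 := coeFn_linkIncl (Finset.subset_univ Φ.systemEdges) T
  have e3 := (measurePreserving_restrictMap (G := G)
    (Finset.subset_univ Φ.systemEdges)).quasiMeasurePreserving.ae
    (isProduct_linkTensor Φ.edges_subset_systemEdges (f : LinkSpace G R.edges)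
      (k : LinkSpace G (Φ.systemEdges \ R.edges)))
  have e4 := (measurePreserving_restrictMap (G := G)
    (Finset.sdiff_subset : Finset.univ \ R.edges ⊆ Finset.univ)).quasiMeasurePreserving.ae
    ((coeFn_mulLp _ c (linkIncl hsub (k : LinkSpace G (Φ.systemEdges \ R.edges)))).and
      (coeFn_linkIncl hsub (k : LinkSpace G (Φ.systemEdges \ R.edges))))
  filter_upwards [e1, e2, e3, e4] with x h1 h2 h3 h4
  refine h1.trans ?_
  rw [h2]
  refine (congrArg _ h3).trans ?_
  have h5 := h4.1
  rw [h4.2, hc] at h5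
  refine Eq.trans ?_ (congrArg _ h5.symm)
  change m (Φ.orientation x) * (_ * _) = _ * (m (Φ.orientation x) * _)
  rw [mul_left_comm]
  rfl

/-- Ampliations of a corner invariant operator are intertwined by the reduction isometry. -/
theorem isAmpliation_reductionAdj {b : physSpace G R R.edges →L[ℂ] physSpace G R R.edges}
    {B : physSpace G R Φ.systemEdges →L[ℂ] physSpace G R Φ.systemEdges}
    {B' : physSpace G R (Finset.univ : Finset E) →L[ℂ] physSpace G R (Finset.univ : Finset E)}
    (hB : IsAmpliation G R Φ.edges_subset_systemEdges b B)
    (hB' : IsAmpliation G R (Finset.subset_univ _) b B')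
    (hinv : ∀ γ ψ, (cornerRep G R Finset.univ).toHom γ (B' ψ) =
      B' ((cornerRep G R Finset.univ).toHom γ ψ))
    (g : ↥R.corner → G) (f : physSpace G R Φ.systemEdges) :
    B' (Φ.reductionAdj G g f) = Φ.reductionAdj G g (B f) := by
  have hcont : Continuous fun k => B' (Φ.reductionAdj G k f) - Φ.reductionAdj G k (B f) :=
    (B'.continuous.comp (Φ.continuous_reductionAdj f)).sub (Φ.continuous_reductionAdj (B f))
  -- It suffices to compare after smearing with m, where the two sides are B'Π(m ⊗ f) and Π(m ⊗ Bf).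
  -- They agree because B' commutes with Π by invariance (`h2`) and passes m ⊗ · to become B (`h1`).
  refine sub_eq_zero.1 (eq_zero_of_integral_smul (haarPi G ↥R.corner) hcont (fun m => ?_) g)
  have hi : ∀ f, Integrable (fun k => m k • Φ.reductionAdj G k f) (haarPi G ↥R.corner) := fun f =>
    UnitaryRep.integrable_of_continuous _ (m.continuous.smul (Φ.continuous_reductionAdj f))
  have h1 := hB.intertwine hB' (Φ.frameTensorPhys m)
    (fun k => Φ.exists_frameTensorPhys_physTensor m k) f
  have h2 : cornerProj G R (B' (Φ.frameTensorPhys m f)) =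
      B' (cornerProj G R (Φ.frameTensorPhys m f)) :=
    UnitaryRep.average_comp_comm _ _ hinv _
  rw [h1, average_frameTensorPhys, average_frameTensorPhys,
    ← ContinuousLinearMap.integral_comp_comm _ (hi f)] at h2
  simp only [smul_sub]
  have h3 := B'.integrable_comp (hi f)
  simp only [map_smul] at h2 h3
  exact (integral_sub h3 (hi (B f))).trans (by rw [h2, sub_self])

/-! #### Relational algebras -/

/-- The relational operator of the region relative to the frame. -/
noncomputable def relationalOp (g : ↥R.corner → G)
    (A : physSpace G R Φ.systemEdges →L[ℂ] physSpace G R Φ.systemEdges) :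
    physSpace G R (Finset.univ : Finset E) →L[ℂ] physSpace G R (Finset.univ : Finset E) :=
  (Φ.reductionAdj G g).toContinuousLinearMap ∘L A ∘L Φ.reduction G g

theorem relationalOp_apply (g : ↥R.corner → G)
    (A : physSpace G R Φ.systemEdges →L[ℂ] physSpace G R Φ.systemEdges)
    (ψ : physSpace G R (Finset.univ : Finset E)) :
    Φ.relationalOp g A ψ = Φ.reductionAdj G g (A (Φ.reduction G g ψ)) := rfl

section Ampliation

variable {a : physSpace G R R.edges →L[ℂ] physSpace G R R.edges}
  {A : physSpace G R Φ.systemEdges →L[ℂ] physSpace G R Φ.systemEdges}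
  {A' : physSpace G R (Finset.univ : Finset E) →L[ℂ] physSpace G R (Finset.univ : Finset E)}

/-- The relational operator of a corner twirl is an electric center operator. -/
theorem relationalOp_twirl (hA : IsAmpliation G R Φ.edges_subset_systemEdges a A)
    (hA' : IsAmpliation G R (Finset.subset_univ _) a A') (g : ↥R.corner → G) :
    Φ.relationalOp g ((cornerRep G R Φ.systemEdges).twirl (haarPi G ↥R.corner) A) =
      cornerProj G R ∘L A' ∘L cornerProj G R := by
  rw [cornerProj_conj]
  ext1 ψ
  -- Writing Πψ as R†Rψ reduces the claim to R† intertwining the two twirled, hence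
  -- corner-invariant, ampliations.
  rw [relationalOp_apply, ContinuousLinearMap.comp_apply, ← Φ.reductionAdj_reduction g ψ]
  exact (Φ.isAmpliation_reductionAdj hA.twirl hA'.twirl
    (fun γ φ => UnitaryRep.toHom_twirl (cornerRep G R Finset.univ) (haarPi G ↥R.corner) A' γ φ)
    g _).symm

/-- Twirling a relational operator over the reorientations twirls it over the corner group. -/
theorem reorientationTwirl_relationalOp (hA : IsAmpliation G R Φ.edges_subset_systemEdges a A)
    (g : ↥R.corner → G) :
    Φ.reorientationTwirl G (Φ.relationalOp g A) =
      Φ.relationalOp g ((cornerRep G R Φ.systemEdges).twirl (haarPi G ↥R.corner) A) := by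
  ext1 ψ
  set U := cornerRep G R Φ.systemEdges
  set W := Φ.reorientPhys (G := G) (Finset.univ : Finset E)
  set φ := Φ.reduction G g ψ with hφ
  -- The adjoint of `reorientPhys_reductionAdj`, obtained from unitarity of all the actions.
  have h1 : ∀ h, Φ.reduction G g (W.toHom h⁻¹ ψ) = (Φ.reorientPhys Φ.systemEdges).toHom h⁻¹
      (U.toHom (g * h * g⁻¹)⁻¹ φ) := fun h => by
    refine ext_inner_left ℂ fun f => ?_
    rw [inner_reduction_right, ← UnitaryRep.inner_toHom_left, ← UnitaryRep.inner_toHom_left,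
      ← UnitaryRep.inner_toHom_left, reorientPhys_reductionAdj, hφ, inner_reduction_right]
  let w : (↥R.corner → G) → physSpace G R (Finset.univ : Finset E) := fun γ =>
    Φ.reductionAdj G g (U.toHom γ (A (U.toHom γ⁻¹ φ)))
  -- The residual reorientations on the two sides commute past A and cancel; only the corner
  -- conjugation by g h g⁻¹ survives.
  have h2 : ∀ h, W.toHom h (Φ.relationalOp g A (W.toHom h⁻¹ ψ)) = w (g * h * g⁻¹) := fun h => by
    rw [relationalOp_apply, h1, Φ.isAmpliation_reorientPhys hA, reorientPhys_reductionAdj,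
      UnitaryRep.toHom_toHom_inv]
  have h3 : Φ.reorientationTwirl G (Φ.relationalOp g A) ψ =
      ∫ h, W.toHom h (Φ.relationalOp g A (W.toHom h⁻¹ ψ)) ∂haarPi G ↥R.corner := rfl
  rw [h3]
  simp only [h2]
  -- The conjugation h ↦ g h g⁻¹ preserves Haar measure, so the chosen orientation g drops out of
  -- the integral.
  rw [integral_mul_left_eq_self (fun h => w (h * g⁻¹)) g, integral_mul_right_eq_self w g⁻¹,
    relationalOp_apply]
  exact (UnitaryRep.map_twirl U (haarPi G ↥R.corner)
    (Φ.reductionAdj G g).toContinuousLinearMap A φ).symm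

variable {Φ Φ'} in
/-- Relational operators are invariant under reorientations of a non-overlapping frame. -/
theorem NonOverlapping.reorientationTwirl_relationalOp (hn : Φ.NonOverlapping Φ')
    (hA : IsAmpliation G R Φ.edges_subset_systemEdges a A) (g : ↥R.corner → G) :
    Φ'.reorientationTwirl G (Φ.relationalOp g A) = Φ.relationalOp g A := by
  ext1 ψ
  set W := Φ'.reorientPhys (G := G) (Finset.univ : Finset E)
  have h1 : ∀ h, Φ.reduction G g (W.toHom h⁻¹ ψ) = (Φ'.reorientPhys Φ.systemEdges).toHom h⁻¹
      (Φ.reduction G g ψ) := fun h => by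
    refine ext_inner_left ℂ fun f => ?_
    rw [inner_reduction_right, ← UnitaryRep.inner_toHom_left, ← UnitaryRep.inner_toHom_left,
      hn.reorientPhys_reductionAdj, inner_reduction_right]
  -- Only reorientations of exterior links occur, and they commute with A; the integrand of the
  -- twirl is constant.
  have h2 : ∀ h, W.toHom h (Φ.relationalOp g A (W.toHom h⁻¹ ψ)) = Φ.relationalOp g A ψ :=
    fun h => by
      rw [relationalOp_apply, h1, Φ'.isAmpliation_reorientPhys hA, hn.reorientPhys_reductionAdj,
        UnitaryRep.toHom_toHom_inv, relationalOp_apply]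
  have h3 : Φ'.reorientationTwirl G (Φ.relationalOp g A) ψ =
      ∫ h, W.toHom h (Φ.relationalOp g A (W.toHom h⁻¹ ψ)) ∂haarPi G ↥R.corner := rfl
  rw [h3]
  simp only [h2, integral_const, probReal_univ, one_smul]

end Ampliation

theorem mem_relationalAlgebra {g : ↥R.corner → G}
    {O : physSpace G R (Finset.univ : Finset E) →L[ℂ] physSpace G R (Finset.univ : Finset E)} :
    O ∈ Φ.relationalAlgebra G g ↔
      ∃ a A, IsAmpliation G R Φ.edges_subset_systemEdges a A ∧ Φ.relationalOp g A = O := by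
  constructor
  · rintro ⟨A, ⟨a, hA⟩, rfl⟩
    exact ⟨a, A, hA, rfl⟩
  · rintro ⟨a, A, hA, rfl⟩
    exact ⟨A, ⟨a, hA⟩, rfl⟩

/-- For A' = a ⊗ 1 on all links, take the ampliation A of the same a on S. Its corner twirl is again
an ampliation, and its relational operator is ΠA'Π. -/
theorem electricCenterAlgebra_subset_relationalAlgebra (g : ↥R.corner → G) :
    electricCenterAlgebra G R ⊆ Φ.relationalAlgebra G g := by
  rintro _ ⟨A', ⟨a, hA'⟩, rfl⟩
  obtain ⟨A, hA⟩ := exists_isAmpliation Φ.edges_subset_systemEdges a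
  exact Φ.mem_relationalAlgebra.2 ⟨_, _, hA.twirl, Φ.relationalOp_twirl hA hA' g⟩

theorem reorientationTwirl_relationalAlgebra (g : ↥R.corner → G) :
    Φ.reorientationTwirl G '' Φ.relationalAlgebra G g = electricCenterAlgebra G R := by
  ext O
  constructor
  · rintro ⟨_, hO, rfl⟩
    obtain ⟨a, A, hA, rfl⟩ := Φ.mem_relationalAlgebra.1 hO
    obtain ⟨A', hA'⟩ := exists_isAmpliation (Finset.subset_univ R.edges) a
    rw [Φ.reorientationTwirl_relationalOp hA, Φ.relationalOp_twirl hA hA']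
    exact ⟨A', ⟨a, hA'⟩, rfl⟩
  · rintro ⟨A', ⟨a, hA'⟩, rfl⟩
    obtain ⟨A, hA⟩ := exists_isAmpliation Φ.edges_subset_systemEdges a
    refine ⟨_, Φ.mem_relationalAlgebra.2 ⟨a, A, hA, rfl⟩, ?_⟩
    rw [Φ.reorientationTwirl_relationalOp hA, Φ.relationalOp_twirl hA hA']

end ExtrinsicFrame

end Frame

end LatticeGauge

theorem mainTheorem2 {G : Type*} [Group G] [TopologicalSpace G] [IsTopologicalGroup G]
    [CompactSpace G] [T2Space G] [SecondCountableTopology G] [MeasurableSpace G] [BorelSpace G]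
    {V E : Type*} [DecidableEq V] [DecidableEq E] [Fintype V] [Fintype E]
    (L : LatticeGauge.Lattice V E) (R : LatticeGauge.Region L)
    (hlarge : ∃ Φ Φ' : LatticeGauge.ExtrinsicFrame R, Φ.NonOverlapping Φ')
    (g : LatticeGauge.ExtrinsicFrame R → ↥R.corner → G) :
    (⋂ Φ : LatticeGauge.ExtrinsicFrame R, Φ.relationalAlgebra G (g Φ)) =
        LatticeGauge.electricCenterAlgebra G R ∧
      LatticeGauge.electricCenterAlgebra G R =
        (fun A => A ∘L LatticeGauge.cornerProj G R) ''
          LatticeGauge.invariantRegionAlgebra G R ∧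
      ∀ Φ : LatticeGauge.ExtrinsicFrame R,
        Φ.reorientationTwirl G '' Φ.relationalAlgebra G (g Φ) =
          LatticeGauge.electricCenterAlgebra G R := by
  refine ⟨Set.Subset.antisymm (fun O hO => ?_) (Set.subset_iInter fun Φ =>
    Φ.electricCenterAlgebra_subset_relationalAlgebra (g Φ)),
    LatticeGauge.electricCenterAlgebra_eq, fun Φ => Φ.reorientationTwirl_relationalAlgebra (g Φ)⟩
  obtain ⟨Φ, Φ', hn⟩ := hlarge
  rw [Set.mem_iInter] at hO
  obtain ⟨a, A, hA, rfl⟩ := Φ.mem_relationalAlgebra.1 (hO Φ)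
  -- The operator plays two roles: as an element of the algebra of Φ it is fixed by the Φ'-twirl,
  -- and as an element of the algebra of Φ' its Φ'-twirl lies in 𝒜_E.
  rw [← Φ'.reorientationTwirl_relationalAlgebra (g Φ')]
  exact ⟨_, hO Φ', hn.reorientationTwirl_relationalOp hA (g Φ)⟩
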